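/- Let $\mathfrak H$ be an infinite-dimensional complex Hilbert space, let $L:\mathfrak D(L)\subseteq\mathfrak H\to\mathfrak H$ be the generator of a strongly continuous semigroup $S:\mathbb R_{\ge0}\to\mathfrak L(\mathfrak H)$ with growth bound $$\omega(S)=\inf\{\omega\in\mathbb R:\ \exists M\ge1\ \ \|S(\tau)\|\le Me^{\omega\tau}\ \text{for all }\tau\ge0\}\in[-\infty,\infty),$$ let $B\subset\mathbb R^n$ be non-empty and compact, and let $\beta\mapsto L'_\beta$ be a map from $B$ to $\mathfrak L(\mathfrak H)$, continuous in the operator norm, such that every $L'_\beta$ is a compact operator. Put $L_\beta=L+L'_\beta$ with $\mathfrak D(L_\beta)=\mathfrak D(L)$, write $\varrho(L_\beta)$, $\sigma(L_\beta)$ for its resolvent set and spectrum and $R_{L_\beta}(z)=(zI-L_\beta)^{-1}$ for its resolvent, fix a real $\omega_0>\omega(S)$, and let $\Sigma_\beta=\sigma(L_\beta)\cap\{z\in\mathbb C:\operatorname{Re}z\ge\omega_0\}$. For every $\beta\in B$, the operator $L_\beta$ generates a unique strongly continuous semigroup $S_\beta$, and $\Sigma_\beta$ is a finite set of isolated points of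 $\sigma(L_\beta)$, so that the total spectral projection $$P_\beta=\sum_{\lambda\in\Sigma_\beta}\frac1{2\pi i}\oint_{|z-\lambda|=r}R_{L_\beta}(z)\,dz$$ is defined, where $r=r(\lambda,\beta)>0$ is chosen such that $\lambda$ is the only point of $\sigma(L_\beta)$ in the closed disk of radius $r$ about $\lambda$. Moreover, the map $z\mapsto R_{L_\beta}(z)(I-P_\beta)$ extends analytically from $\varrho(L_\beta)$ to $\varrho(L_\beta)\cup\Sigma_\beta$, and the extension is denoted in the same way. Then the following are equivalent. 1. There exist $\omega<\omega_0$ and $M_\omega\ge1$ such that $\|S_\beta(\tau)(I-P_\beta)\|\le M_\omega e^{\omega\tau}\|I-P_\beta\|$ for all $\tau\ge0$ and all $\beta\in B$. 2. There exists $C_{\omega_0}>0$ such that $\|R_{L_\beta}(z)(I-P_\beta)\|\le C_{\omega_0}$ for all $z\in\mathbb C$ with $\operatorname{Re}z\ge\omega_0$ and all $\beta\in B$. -/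

import Mathlib

open Filter Topology
open scoped NNReal

/-- A strongly continuous one-parameter semigroup of bounded linear operators on `H`. -/
structure C0Semigroup (H : Type*) [NormedAddCommGroup H] [NormedSpace ℂ H] where
  /-- The operator at time `τ ≥ 0`. -/
  toFun : ℝ≥0 → H →L[ℂ] H
  map_zero' : toFun 0 = ContinuousLinearMap.id ℂ H
  map_add' : ∀ s t : ℝ≥0, toFun (s + t) = (toFun s).comp (toFun t)
  continuous_orbit' : ∀ x : H, Continuous fun t : ℝ≥0 => toFun t x

namespace C0Semigroup

variable {H : Type*} [NormedAddCommGroup H] [NormedSpace ℂ H]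

instance : CoeFun (C0Semigroup H) (fun _ => ℝ≥0 → H →L[ℂ] H) := ⟨C0Semigroup.toFun⟩

/-- `y = lim_{t → 0+} (S(t) x - x) / t`. -/
def HasGeneratorAt (S : C0Semigroup H) (x y : H) : Prop :=
  Tendsto (fun t : ℝ≥0 => (((t : ℝ) : ℂ)⁻¹) • (S t x - x)) (𝓝[>] 0) (𝓝 y)

theorem HasGeneratorAt.unique {S : C0Semigroup H} {x y y' : H}
    (h : S.HasGeneratorAt x y) (h' : S.HasGeneratorAt x y') : y = y' :=
  tendsto_nhds_unique h h'

theorem HasGeneratorAt.add {S : C0Semigroup H} {x x' y y' : H}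
    (h : S.HasGeneratorAt x y) (h' : S.HasGeneratorAt x' y') :
    S.HasGeneratorAt (x + x') (y + y') := by
  refine (Tendsto.add h h').congr fun t => ?_
  rw [← smul_add, map_add]
  congr 1
  abel

theorem HasGeneratorAt.smul {S : C0Semigroup H} {x y : H} (c : ℂ)
    (h : S.HasGeneratorAt x y) : S.HasGeneratorAt (c • x) (c • y) := by
  refine (Tendsto.const_smul h c).congr fun t => ?_
  rw [smul_comm, smul_sub, map_smul]

theorem HasGeneratorAt.zero (S : C0Semigroup H) : S.HasGeneratorAt 0 0 := by
  simp [HasGeneratorAt]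

/-- The (infinitesimal) generator of a strongly continuous semigroup, an unbounded operator whose
domain consists of all `x` for which `lim_{t → 0+} (S(t) x - x) / t` exists. -/
noncomputable def generator (S : C0Semigroup H) : H →ₗ.[ℂ] H where
  domain :=
    { carrier := {x | ∃ y, S.HasGeneratorAt x y}
      add_mem' := fun ⟨y, h⟩ ⟨y', h'⟩ => ⟨y + y', h.add h'⟩
      zero_mem' := ⟨0, HasGeneratorAt.zero S⟩
      smul_mem' := fun c _ ⟨y, h⟩ => ⟨c • y, h.smul c⟩ }
  toFun :=
    { toFun := fun x => x.2.choose
      map_add' := fun x x' =>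
        (x + x').2.choose_spec.unique (x.2.choose_spec.add x'.2.choose_spec)
      map_smul' := fun c x => (c • x).2.choose_spec.unique (x.2.choose_spec.smul c) }

/-- The growth bound `ω(S)`, the infimum of all real `ω` such that `‖S(τ)‖ ≤ M e^{ωτ}` for some
`M ≥ 1` and all `τ ≥ 0`. It takes values in the extended reals since it may be `-∞`. -/
noncomputable def growthBound (S : C0Semigroup H) : EReal :=
  sInf ((fun ω : ℝ => (ω : EReal)) ''
    {ω : ℝ | ∃ M : ℝ, 1 ≤ M ∧ ∀ τ : ℝ≥0, ‖S τ‖ ≤ M * Real.exp (ω * τ)})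

end C0Semigroup

namespace UnboundedOperator

variable {H : Type*} [NormedAddCommGroup H] [NormedSpace ℂ H]

/-- The operator `A + K` with domain `D(A)`, for `K` bounded. -/
def perturb (A : H →ₗ.[ℂ] H) (K : H →L[ℂ] H) : H →ₗ.[ℂ] H where
  domain := A.domain
  toFun := A.toFun + (K : H →ₗ[ℂ] H).comp A.domain.subtype

/-- `R` is a bounded two-sided inverse of `z I - A : D(A) → H`. -/
def IsResolventAt (A : H →ₗ.[ℂ] H) (z : ℂ) (R : H →L[ℂ] H) : Prop :=
  (∀ x : H, ∃ h : R x ∈ A.domain, z • R x - A ⟨R x, h⟩ = x) ∧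
    ∀ x : A.domain, R (z • (x : H) - A x) = x

/-- The resolvent set `ϱ(A)`. -/
def resolventSet (A : H →ₗ.[ℂ] H) : Set ℂ := {z | ∃ R, IsResolventAt A z R}

/-- The spectrum `σ(A)`. -/
def spec (A : H →ₗ.[ℂ] H) : Set ℂ := (resolventSet A)ᶜ

open Classical in
/-- The resolvent `R_A(z) = (z I - A)⁻¹` for `z ∈ ϱ(A)` (and `0` elsewhere). -/
noncomputable def resolvent (A : H →ₗ.[ℂ] H) (z : ℂ) : H →L[ℂ] H :=
  if h : ∃ R, IsResolventAt A z R then h.choose else 0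

/-- `μ` is the only spectral point of `A` in the closed disk of radius `r > 0` about `μ`. -/
def IsIsolatingRadius (A : H →ₗ.[ℂ] H) (μ : ℂ) (r : ℝ) : Prop :=
  0 < r ∧ Metric.closedBall μ r ∩ spec A = {μ}

open Classical in
/-- The spectral (Riesz) projection `(2πi)⁻¹ ∮ R_A(z) dz` of `A` at an isolated point `μ` of the
spectrum. The integral does not depend on the isolating radius. -/
noncomputable def spectralProjection (A : H →ₗ.[ℂ] H) (μ : ℂ) : H →L[ℂ] H :=
  if h : ∃ r, IsIsolatingRadius A μ r then
    (2 * Real.pi * Complex.I : ℂ)⁻¹ • ∮ z in C(μ, h.choose), resolvent A z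
  else 0

/-- The part `σ(A) ∩ {Re z ≥ ω₀}` of the spectrum. -/
def specRight (A : H →ₗ.[ℂ] H) (ω₀ : ℝ) : Set ℂ := spec A ∩ {z | ω₀ ≤ z.re}

/-- The total projection, the sum of the spectral projections over `σ(A) ∩ {Re z ≥ ω₀}`. -/
noncomputable def totalProjection (A : H →ₗ.[ℂ] H) (ω₀ : ℝ) : H →L[ℂ] H :=
  ∑ᶠ μ ∈ specRight A ω₀, spectralProjection A μ

open Classical in
/-- The reduced resolvent `z ↦ R_A(z) (I - P)`, where `P` is the total projection, extended to the
points of `σ(A) ∩ {Re z ≥ ω₀}` by its limit. -/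
noncomputable def reducedResolvent (A : H →ₗ.[ℂ] H) (ω₀ : ℝ) (z : ℂ) : H →L[ℂ] H :=
  if z ∈ specRight A ω₀ then
    limUnder (𝓝[≠] z) fun w =>
      (resolvent A w).comp (ContinuousLinearMap.id ℂ H - totalProjection A ω₀)
  else (resolvent A z).comp (ContinuousLinearMap.id ℂ H - totalProjection A ω₀)

end UnboundedOperator

/-! The parameter β matters only through K = L'_β, which ranges over a compact set 𝒦 of compact
operators; the point is to keep all constants uniform over 𝒦.

To the right of the growth bound, z - L - K = (1 - K R(z))(z - L), where R is the resolvent of L.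
The compact operators K R(z) tend to 0 in norm at infinity in a closed half-plane, uniformly on 𝒦
(`eventually_norm_mul_resolvent_lt`). Analytic Fredholm theory then shows that the spectrum there
consists of isolated eigenvalues; in Re z ≥ ω₀ it is finite and lies in a ball common to all K.

Both implications rest on a spectral gap: for some ω₁ < ω₀ no L + K has spectrum in ω₁ ≤ Re z < ω₀.
An eigenvector belonging to this strip is killed by P, so its orbit would grow too fast for
condition 1, and the resolvent at a nearby point would be too large for condition 2. Given the gap,
Σ is surrounded by a circle inside the resolvent set, and P is the Riesz integral over it
(`totalProjection_eq_rieszIntegral`).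

1 ⇒ 2: the circle can be taken the same for all K, so ‖I - P‖ is uniformly bounded, and the reduced
resolvent is the Laplace transform of the decaying orbits of (I - P)x.

2 ⇒ 1: the resolvent bound extends to Re z ≥ ω₁ with 2C in place of C. A quantitative Gearhart–Prüss
theorem (`exists_growth_bound_of_resolvent_bound`) converts it into growth: Plancherel gives L²
bounds for orbits, and these give pointwise bounds. Its constants depend only on C, ω₁ and a growth
estimate for S_β that the bounded perturbation theorem makes uniform. -/

namespace C0Semigroup

/-! ### Orbits, generators and uniqueness of the generated semigroup. -/

open MeasureTheory Set

variable {H : Type*} [NormedAddCommGroup H] [NormedSpace ℂ H]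

/-- The orbit `t ↦ S(t) x`, extended to all real times by its value at `0`. -/
def orbit (S : C0Semigroup H) (x : H) (t : ℝ) : H := S t.toNNReal x

theorem continuous_orbit (S : C0Semigroup H) (x : H) : Continuous (S.orbit x) :=
  (S.continuous_orbit' x).comp continuous_real_toNNReal

@[simp] theorem orbit_zero (S : C0Semigroup H) (x : H) : S.orbit x 0 = x := by
  simp [orbit, S.map_zero']

theorem zero_apply (S : C0Semigroup H) (x : H) : S 0 x = x := by
  rw [S.map_zero']; rfl

theorem orbit_coe (S : C0Semigroup H) (x : H) (t : ℝ≥0) : S.orbit x t = S t x := by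
  simp [orbit]

theorem add_apply (S : C0Semigroup H) (s t : ℝ≥0) (x : H) : S (s + t) x = S s (S t x) := by
  rw [S.map_add']; rfl

theorem comm_apply (S : C0Semigroup H) (s t : ℝ≥0) (x : H) : S s (S t x) = S t (S s x) := by
  rw [← add_apply, add_comm, add_apply]

theorem orbit_add (S : C0Semigroup H) (x : H) {s t : ℝ} (hs : 0 ≤ s) (ht : 0 ≤ t) :
    S.orbit x (s + t) = S s.toNNReal (S.orbit x t) := by
  rw [orbit, Real.toNNReal_add hs ht, add_apply, orbit]

/-- Turns the generator into a one-sided derivative of the orbit on ℝ, so that real calculus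
applies. -/
theorem hasGeneratorAt_iff {S : C0Semigroup H} {x y : H} :
    S.HasGeneratorAt x y ↔ HasDerivWithinAt (S.orbit x) y (Ici 0) 0 := by
  rw [← hasDerivWithinAt_Ioi_iff_Ici, hasDerivWithinAt_iff_tendsto_slope' (by simp),
    ← NNReal.coe_zero, ← NNReal.map_coe_nhdsGT, tendsto_map'_iff]
  refine tendsto_congr fun t => ?_
  simp only [Function.comp, slope, NNReal.coe_zero, orbit_zero, vsub_eq_sub, sub_zero, orbit_coe]
  rw [← Complex.ofReal_inv, Complex.coe_smul]

theorem hasGeneratorAt_generator (S : C0Semigroup H) (x : S.generator.domain) :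
    S.HasGeneratorAt x (S.generator x) := x.2.choose_spec

theorem HasGeneratorAt.generator_apply {S : C0Semigroup H} {x y : H} (h : S.HasGeneratorAt x y) :
    S.generator ⟨x, y, h⟩ = y :=
  (S.hasGeneratorAt_generator ⟨x, y, h⟩).unique h

theorem generator_eq_iff {S : C0Semigroup H} {A : H →ₗ.[ℂ] H} :
    S.generator = A ↔ ∀ x y, S.HasGeneratorAt x y ↔ ∃ h : x ∈ A.domain, A ⟨x, h⟩ = y := by
  constructor
  · rintro rfl x y
    exact ⟨fun h => ⟨⟨y, h⟩, h.generator_apply⟩,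
      fun ⟨h, e⟩ => e ▸ S.hasGeneratorAt_generator ⟨x, h⟩⟩
  · intro h
    refine LinearPMap.ext (Submodule.ext fun x => ?_) fun x hx hx' => ?_
    · exact ⟨fun ⟨y, hy⟩ => ((h x y).1 hy).1, fun hx => ⟨_, (h x _).2 ⟨hx, rfl⟩⟩⟩
    · exact ((h x _).2 ⟨hx', rfl⟩).generator_apply

theorem hasGeneratorAt_iff_of_generator_eq {S T : C0Semigroup H} (h : T.generator = S.generator)
    {x y : H} : T.HasGeneratorAt x y ↔ S.HasGeneratorAt x y := by
  rw [generator_eq_iff.1 h, ← generator_eq_iff.1 rfl]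

theorem HasGeneratorAt.apply {S : C0Semigroup H} {x y : H} (h : S.HasGeneratorAt x y) (t : ℝ≥0) :
    S.HasGeneratorAt (S t x) (S t y) := by
  refine (((S t).continuous.tendsto y).comp h).congr fun s => ?_
  simp only [Function.comp, map_smul, map_sub, S.comm_apply s t]

theorem HasGeneratorAt.hasDerivWithinAt {S : C0Semigroup H} {x y : H} (h : S.HasGeneratorAt x y)
    {t : ℝ} (ht : 0 ≤ t) : HasDerivWithinAt (S.orbit x) (S.orbit y t) (Ici t) t := by
  have h1 := hasGeneratorAt_iff.1 (h.apply t.toNNReal)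
  have h2 : HasDerivWithinAt (fun s : ℝ => s - t) 1 (Ici t) t :=
    ((hasDerivAt_id t).sub_const t).hasDerivWithinAt
  have h3 := HasDerivWithinAt.scomp (t' := Ici 0) (h := fun s : ℝ => s - t) (x := t)
    (g₁ := S.orbit (S t.toNNReal x)) (g₁' := S t.toNNReal y) (h' := 1) (s := Ici t)
    (by simpa using h1) h2 (fun s hs => by simpa using hs)
  rw [one_smul] at h3
  refine h3.congr (fun s hs => ?_) ?_
  · have hs' : t ≤ s := hs
    have := S.orbit_add x (s := s - t) (t := t) (by linarith) ht
    rw [sub_add_cancel] at this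
    rw [this]; rfl
  · simp [Function.comp, orbit, S.zero_apply]

/-- The rescaled semigroup `e^{-zt} S(t)`. -/
noncomputable def rescale (S : C0Semigroup H) (z : ℂ) : C0Semigroup H where
  toFun t := Complex.exp (-z * (t : ℝ)) • S t
  map_zero' := by simp [S.map_zero']
  map_add' s t := by
    ext x
    simp only [_root_.smul_apply, ContinuousLinearMap.comp_apply, map_smul,
      S.add_apply, smul_smul, ← Complex.exp_add]
    congr 2
    push_cast; ring
  continuous_orbit' x := by
    have := S.continuous_orbit' x
    simp only [_root_.smul_apply]
    fun_prop

theorem rescale_apply (S : C0Semigroup H) (z : ℂ) (t : ℝ≥0) (x : H) :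
    S.rescale z t x = Complex.exp (-z * (t : ℝ)) • S t x := rfl

theorem norm_rescale (S : C0Semigroup H) (z : ℂ) (t : ℝ≥0) (x : H) :
    ‖S.rescale z t x‖ = Real.exp (-z.re * t) * ‖S t x‖ := by
  rw [rescale_apply, norm_smul, Complex.norm_exp]
  simp

theorem rescale_rescale_neg (S : C0Semigroup H) (z : ℂ) (t : ℝ≥0) (x : H) :
    (S.rescale z).rescale (-z) t x = S t x := by
  rw [rescale_apply, rescale_apply, smul_smul, ← Complex.exp_add]
  simp

theorem HasGeneratorAt.rescale {S : C0Semigroup H} {x y : H} (h : S.HasGeneratorAt x y) (z : ℂ) :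
    (S.rescale z).HasGeneratorAt x (y - z • x) := by
  rw [hasGeneratorAt_iff] at h ⊢
  have h2 : HasDerivAt (fun t : ℝ => Complex.exp (-z * (t : ℂ))) (-z) 0 := by
    have h3 : HasDerivAt (fun t : ℂ => Complex.exp (-z * t)) (-z) ((0 : ℝ) : ℂ) := by
      have := ((hasDerivAt_id ((0 : ℝ) : ℂ)).const_mul (-z)).cexp
      simpa using this
    exact h3.comp_ofReal
  have h4 := h2.hasDerivWithinAt (s := Ici 0) |>.smul h
  have e : Complex.exp (-z * ((0 : ℝ) : ℂ)) • y + (-z) • S.orbit x 0 = y - z • x := by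
    simp [sub_eq_add_neg]
  rw [e] at h4
  refine h4.congr (fun t ht => ?_) ?_
  · have ht' : 0 ≤ t := ht
    simp [orbit, rescale_apply, ht']
  · simp [orbit, rescale_apply]

theorem hasGeneratorAt_rescale_iff {S : C0Semigroup H} {x y : H} {z : ℂ} :
    (S.rescale z).HasGeneratorAt x y ↔ S.HasGeneratorAt x (y + z • x) := by
  refine ⟨fun h => ?_, fun h => by simpa using h.rescale z⟩
  have := h.rescale (-z)
  simp only [neg_smul, sub_neg_eq_add] at this
  simpa only [HasGeneratorAt, rescale_rescale_neg] using this

section Integral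

variable [CompleteSpace H]

theorem integral_orbit_apply (S : C0Semigroup H) (x : H) (a b : ℝ) (ha : 0 ≤ a) (hb : 0 ≤ b)
    {h : ℝ} (hh : 0 ≤ h) :
    S h.toNNReal (∫ t in a..b, S.orbit x t) = ∫ t in (a + h)..(b + h), S.orbit x t := by
  rw [← intervalIntegral.integral_comp_add_right,
    ← ContinuousLinearMap.intervalIntegral_comp_comm _
      ((S.continuous_orbit x).intervalIntegrable _ _)]
  refine intervalIntegral.integral_congr fun t ht => ?_
  have ht' : 0 ≤ t := le_trans (le_min ha hb) (by simpa using ht.1)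
  rw [add_comm t h, S.orbit_add x hh ht']

/-- S(h) shifts the window of integration, so the orbit of the integral is ∫₀^{r+h} - ∫₀^h, which
the fundamental theorem of calculus differentiates at h = 0. -/
theorem hasGeneratorAt_integral (S : C0Semigroup H) (x : H) {r : ℝ} (hr : 0 ≤ r) :
    S.HasGeneratorAt (∫ t in (0 : ℝ)..r, S.orbit x t) (S.orbit x r - x) := by
  rw [hasGeneratorAt_iff]
  have hc := S.continuous_orbit x
  have h1 (u : ℝ) : HasDerivAt (fun h : ℝ => ∫ t in (0 : ℝ)..(u + h), S.orbit x t)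
      (S.orbit x u) 0 := by
    have h2 : HasDerivAt (fun u : ℝ => ∫ t in (0 : ℝ)..u, S.orbit x t) (S.orbit x (u + 0)) (u + 0) :=
      intervalIntegral.integral_hasDerivAt_right (hc.intervalIntegrable _ _)
        hc.stronglyMeasurable.stronglyMeasurableAtFilter hc.continuousAt
    have := HasDerivAt.comp_const_add u 0 h2
    simpa using this
  have h3 := ((h1 r).sub (h1 0)).hasDerivWithinAt (s := Ici 0)
  rw [orbit_zero] at h3
  refine h3.congr (fun h hh => ?_) ?_
  · have hh' : 0 ≤ h := hh
    change S h.toNNReal _ = _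
    rw [integral_orbit_apply _ _ _ _ le_rfl hr hh']
    simp only [Pi.sub_apply]
    rw [intervalIntegral.integral_interval_sub_left (hc.intervalIntegrable _ _)
      (hc.intervalIntegrable _ _)]
  · simp

theorem hasGeneratorAt_integral_Ioi (S : C0Semigroup H) (x : H)
    (hi : IntegrableOn (S.orbit x) (Ioi 0)) :
    S.HasGeneratorAt (∫ t in Ioi (0 : ℝ), S.orbit x t) (-x) := by
  rw [hasGeneratorAt_iff]
  have hc := S.continuous_orbit x
  have h1 : HasDerivAt (fun h : ℝ => ∫ t in (0 : ℝ)..h, S.orbit x t) (S.orbit x 0) 0 :=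
    intervalIntegral.integral_hasDerivAt_right (hc.intervalIntegrable _ _)
      hc.stronglyMeasurable.stronglyMeasurableAtFilter hc.continuousAt
  have h3 := (h1.const_sub (∫ t in Ioi (0 : ℝ), S.orbit x t)).hasDerivWithinAt (s := Ici 0)
  rw [orbit_zero] at h3
  refine h3.congr (fun h hh => ?_) ?_
  · have hh' : 0 ≤ h := hh
    change S h.toNNReal _ = _
    rw [← ContinuousLinearMap.integral_comp_comm _ hi]
    have e : ∫ t in Ioi (0 : ℝ), S h.toNNReal (S.orbit x t) = ∫ t in Ioi h, S.orbit x t := by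
      have := (measurePreserving_add_right volume h).setIntegral_preimage_emb
        (measurableEmbedding_addRight h) (S.orbit x) (Ioi h)
      simp only [preimage_add_const_Ioi, sub_self] at this
      rw [← this]
      refine setIntegral_congr_fun measurableSet_Ioi fun t ht => ?_
      have ht' : 0 ≤ t := le_of_lt ht
      rw [add_comm t h, S.orbit_add x hh' ht']
    rw [e, eq_sub_iff_add_eq, add_comm]
    exact intervalIntegral.integral_interval_add_Ioi hi (hi.mono_set (Ioi_subset_Ioi hh'))
  · simp

/-- The averages t⁻¹ ∫₀ᵗ S(s) x ds lie in the domain and tend to x. -/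
theorem dense_generator_domain (S : C0Semigroup H) : Dense {x | ∃ y, S.HasGeneratorAt x y} := by
  intro x
  have hc := S.continuous_orbit x
  have h1 : HasDerivAt (fun h : ℝ => ∫ t in (0 : ℝ)..h, S.orbit x t) (S.orbit x 0) 0 :=
    intervalIntegral.integral_hasDerivAt_right (hc.intervalIntegrable _ _)
      hc.stronglyMeasurable.stronglyMeasurableAtFilter hc.continuousAt
  rw [orbit_zero] at h1
  have h2 := (hasDerivWithinAt_iff_tendsto_slope' (by simp)).1 (h1.hasDerivWithinAt (s := Ioi 0))
  refine mem_closure_of_tendsto h2 ?_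
  filter_upwards [self_mem_nhdsWithin] with t (ht : 0 < t)
  have := (S.hasGeneratorAt_integral x ht.le).smul ((t : ℂ)⁻¹)
  have e : slope (fun h : ℝ => ∫ t in (0 : ℝ)..h, S.orbit x t) 0 t
      = (t : ℂ)⁻¹ • ∫ t in (0 : ℝ)..t, S.orbit x t := by
    simp [slope, ← Complex.ofReal_inv]
  exact ⟨_, e ▸ this⟩

/-- A semigroup is determined by its generator. -/
theorem eq_of_generator_eq {S T : C0Semigroup H} {M ω : ℝ}
    (hS : ∀ t : ℝ≥0, ‖S t‖ ≤ M * Real.exp (ω * t)) (h : T.generator = S.generator) : T = S := by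
  suffices hm : ∀ t : ℝ≥0, ∀ x ∈ {x | ∃ y, T.HasGeneratorAt x y}, T t x = S t x by
    obtain ⟨f, _, _, _⟩ := S
    obtain ⟨g, _, _, _⟩ := T
    have : g = f := funext fun t => DFunLike.coe_injective <|
      Continuous.ext_on (dense_generator_domain _) (g t).continuous (f t).continuous (hm t)
    subst this; rfl
  rintro t x ⟨y, hy⟩
  have hM0 : 0 ≤ M := by have := (norm_nonneg _).trans (hS 0); simpa using this
  set N := M * Real.exp (|ω| * t) with hN
  have hbd (s : ℝ≥0) (hs : s ≤ t) : ‖S s‖ ≤ N := by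
    refine (hS s).trans ?_
    rw [hN]
    gcongr
    exact le_abs_self ω
  have hbd' (s : ℝ) (v : H) (hs : 0 ≤ s) : ‖S (t - s : ℝ).toNNReal v‖ ≤ N * ‖v‖ := by
    refine ContinuousLinearMap.le_of_opNorm_le _ (hbd _ ?_) v
    rw [Real.toNNReal_le_iff_le_coe]; linarith
  -- The path s ↦ S(t - s) T(s) x joins S(t) x to T(t) x and has right derivative zero.
  have key := constant_of_has_deriv_right_zero (f := fun s : ℝ => S (t - s : ℝ).toNNReal (T.orbit x s))
    (a := 0) (b := t) ?_ ?_ t ⟨t.2, le_rfl⟩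
  · simpa [orbit, S.zero_apply, T.zero_apply] using key
  · intro s hs
    have e : Tendsto (fun r : ℝ => S (t - r : ℝ).toNNReal (T.orbit x r - T.orbit x s)) (𝓝[Icc 0 (t:ℝ)] s)
        (𝓝 0) := by
      have h0 : Tendsto (fun r : ℝ => N * ‖T.orbit x r - T.orbit x s‖) (𝓝[Icc 0 (t:ℝ)] s) (𝓝 0) := by
        have hc := T.continuous_orbit x
        have : Continuous fun r : ℝ => N * ‖T.orbit x r - T.orbit x s‖ := by fun_prop
        simpa using (this.tendsto s).mono_left nhdsWithin_le_nhds
      refine squeeze_zero_norm' ?_ h0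
      filter_upwards [self_mem_nhdsWithin] with r hr
      exact hbd' r _ hr.1
    have e2 : Tendsto (fun r : ℝ => S (t - r : ℝ).toNNReal (T.orbit x s)) (𝓝[Icc 0 (t:ℝ)] s)
        (𝓝 (S (t - s : ℝ).toNNReal (T.orbit x s))) := by
      have : Continuous fun r : ℝ => S (t - r : ℝ).toNNReal (T.orbit x s) :=
        (S.continuous_orbit' (T.orbit x s)).comp (by fun_prop)
      exact (this.tendsto s).mono_left nhdsWithin_le_nhds
    have := e.add e2
    simpa [ContinuousWithinAt] using this
  · intro s hs
    have hTs : T.HasGeneratorAt (T.orbit x s) (T.orbit y s) := hy.apply _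
    have hSs : S.HasGeneratorAt (T.orbit x s) (T.orbit y s) :=
      (hasGeneratorAt_iff_of_generator_eq h).1 hTs
    rw [← hasDerivWithinAt_Ioi_iff_Ici, hasDerivWithinAt_iff_tendsto_slope' (by simp)]
    have hT' := hasGeneratorAt_iff.1 hTs
    have hS' := hasGeneratorAt_iff.1 hSs
    -- Both orbits of T(s) x start with the same velocity, so their difference is o(r - s), and S(t
    -- - r) costs only the factor N.
    have hd := hT'.sub hS'
    rw [sub_self, ← hasDerivWithinAt_Ioi_iff_Ici, hasDerivWithinAt_iff_tendsto_slope' (by simp)] at hd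
    have hshift : Tendsto (fun r : ℝ => r - s) (𝓝[>] s) (𝓝[>] 0) := by
      refine tendsto_nhdsWithin_iff.2 ⟨?_, ?_⟩
      · have : Continuous fun r : ℝ => r - s := by fun_prop
        simpa using (this.tendsto s).mono_left nhdsWithin_le_nhds
      · filter_upwards [self_mem_nhdsWithin] with r hr
        simpa using hr
    have h0 := (hd.comp hshift).norm.const_mul N
    rw [norm_zero, mul_zero] at h0
    refine squeeze_zero_norm' ?_ h0
    filter_upwards [Ioo_mem_nhdsGT hs.2] with r hr
    have hrs : 0 ≤ r - s := by linarith [hr.1]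
    have e1 : T.orbit x r = T.orbit (T.orbit x s) (r - s) := by
      have := T.orbit_add x (s := r - s) (t := s) hrs hs.1
      rw [sub_add_cancel] at this
      rw [this]; rfl
    have e2 : S (t - s : ℝ).toNNReal (T.orbit x s)
        = S (t - r : ℝ).toNNReal (S.orbit (T.orbit x s) (r - s)) := by
      have : (t - s : ℝ) = (t - r) + (r - s) := by ring
      rw [this, Real.toNNReal_add (by linarith [hr.2]) hrs, add_apply]; rfl
    have e3 : slope (fun s : ℝ => S (t - s : ℝ).toNNReal (T.orbit x s)) s r
        = S (t - r : ℝ).toNNReal (slope (T.orbit (T.orbit x s) - S.orbit (T.orbit x s)) 0 (r - s)) := by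
      simp only [slope, vsub_eq_sub, sub_zero, Pi.sub_apply, orbit_zero, sub_self]
      rw [e2, e1, ← map_sub, ← Complex.coe_smul, ← Complex.coe_smul, map_smul]
    rw [e3]
    exact hbd' r _ (by linarith [hs.1, hr.1])

end Integral

end C0Semigroup

/-! ### Bounded perturbations through Duhamel's equation. -/

namespace C0Semigroup

open MeasureTheory Set

variable {H : Type*} [NormedAddCommGroup H] [NormedSpace ℂ H]

/-- An exponentially bounded strongly continuous semigroup is jointly continuous. -/
theorem continuous_uncurry {S : C0Semigroup H} {M ω : ℝ}
    (hS : ∀ t : ℝ≥0, ‖S t‖ ≤ M * Real.exp (ω * t)) :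
    Continuous fun p : ℝ≥0 × H => S p.1 p.2 := by
  rw [continuous_iff_continuousAt]
  rintro ⟨t, x⟩
  have h1 : Tendsto (fun p : ℝ≥0 × H => S p.1 (p.2 - x)) (𝓝 (t, x)) (𝓝 0) := by
    have h0 : Tendsto (fun p : ℝ≥0 × H => M * Real.exp (ω * p.1) * ‖p.2 - x‖) (𝓝 (t, x)) (𝓝 0) := by
      have : Continuous fun p : ℝ≥0 × H => M * Real.exp (ω * p.1) * ‖p.2 - x‖ := by fun_prop
      simpa using this.tendsto (t, x)
    exact squeeze_zero_norm (fun p => ContinuousLinearMap.le_of_opNorm_le _ (hS p.1) _) h0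
  have h2 : Tendsto (fun p : ℝ≥0 × H => S p.1 x) (𝓝 (t, x)) (𝓝 (S t x)) :=
    ((S.continuous_orbit' x).comp continuous_fst).tendsto (t, x)
  simpa [ContinuousAt] using h1.add h2

section Duhamel

open BoundedContinuousFunction

/-- The integrand of the Duhamel integral, extended to all real times. -/
def duhamelIntegrand (U : C0Semigroup H) (K : H →L[ℂ] H) (v : ℝ≥0 → H) (t s : ℝ) : H :=
  U (t - s).toNNReal (K (v s.toNNReal))

/-- The Duhamel integral `∫₀ᵗ U(t - s) K v(s) ds`. -/
noncomputable def duhamel (U : C0Semigroup H) (K : H →L[ℂ] H) (v : ℝ≥0 → H) (t : ℝ) : H :=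
  ∫ s in (0 : ℝ)..t, duhamelIntegrand U K v t s

variable {U : C0Semigroup H} {K : H →L[ℂ] H} {M μ : ℝ}

theorem continuous_duhamelIntegrand (hU : ∀ t : ℝ≥0, ‖U t‖ ≤ M * Real.exp (-μ * t))
    {v : ℝ≥0 → H} (hv : Continuous v) :
    Continuous fun p : ℝ × ℝ => duhamelIntegrand U K v p.1 p.2 := by
  refine (continuous_uncurry hU).comp (f := fun p : ℝ × ℝ =>
    ((p.1 - p.2).toNNReal, K (v p.2.toNNReal))) ?_
  have := K.continuous
  fun_prop

theorem continuous_duhamel (hU : ∀ t : ℝ≥0, ‖U t‖ ≤ M * Real.exp (-μ * t))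
    {v : ℝ≥0 → H} (hv : Continuous v) : Continuous (duhamel U K v) :=
  intervalIntegral.continuous_parametric_intervalIntegral_of_continuous
    (continuous_duhamelIntegrand hU hv) continuous_id

theorem intervalIntegrable_duhamelIntegrand (hU : ∀ t : ℝ≥0, ‖U t‖ ≤ M * Real.exp (-μ * t))
    {v : ℝ≥0 → H} (hv : Continuous v) (t a b : ℝ) :
    IntervalIntegrable (duhamelIntegrand U K v t) volume a b :=
  ((continuous_duhamelIntegrand hU hv).comp (Continuous.prodMk_right t)).intervalIntegrable _ _

/-- The kernel e^{-μ(t-s)} has integral at most 1/μ over [0, t], whatever t is; this makes the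
Duhamel operator a contraction when M‖K‖ is small compared with μ. -/
theorem norm_duhamel_le (hU : ∀ t : ℝ≥0, ‖U t‖ ≤ M * Real.exp (-μ * t)) (hμ : 0 < μ)
    {v : ℝ≥0 → H} {N : ℝ} (hN : ∀ t, ‖v t‖ ≤ N) {t : ℝ} (ht : 0 ≤ t) :
    ‖duhamel U K v t‖ ≤ M * ‖K‖ / μ * N := by
  have hM0 : 0 ≤ M := by have := (norm_nonneg _).trans (hU 0); simpa using this
  have hN0 : 0 ≤ N := (norm_nonneg _).trans (hN 0)
  have hint : ∫ s in (0 : ℝ)..t, Real.exp (-μ * (t - s)) ≤ 1 / μ := by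
    have hd : ∀ s ∈ uIcc 0 t, HasDerivAt (fun s : ℝ => Real.exp (-μ * (t - s)) / μ)
        (Real.exp (-μ * (t - s))) s := by
      intro s _
      have := ((((hasDerivAt_id s).const_sub t).const_mul (-μ)).exp).div_const μ
      refine this.congr_deriv ?_
      simp only [id]
      field_simp
    rw [intervalIntegral.integral_eq_sub_of_hasDerivAt hd
      (by apply Continuous.intervalIntegrable; fun_prop)]
    simp only [sub_self, mul_zero, Real.exp_zero, sub_zero, sub_le_self_iff]
    positivity
  calc ‖duhamel U K v t‖ ≤ ∫ s in (0 : ℝ)..t, M * ‖K‖ * N * Real.exp (-μ * (t - s)) := by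
        refine intervalIntegral.norm_integral_le_of_norm_le ht (ae_of_all _ fun s hs => ?_)
          (by apply Continuous.intervalIntegrable; fun_prop)
        have hts : 0 ≤ t - s := sub_nonneg.2 hs.2
        have h1 := hU (t - s).toNNReal
        rw [Real.coe_toNNReal _ hts] at h1
        calc ‖duhamelIntegrand U K v t s‖ ≤ (M * Real.exp (-μ * (t - s))) * (‖K‖ * N) :=
              (ContinuousLinearMap.le_of_opNorm_le_of_le _ h1
                (ContinuousLinearMap.le_opNorm_of_le _ (hN _)))
          _ = _ := by ring
    _ = M * ‖K‖ * N * ∫ s in (0 : ℝ)..t, Real.exp (-μ * (t - s)) := by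
        rw [intervalIntegral.integral_const_mul]
    _ ≤ M * ‖K‖ * N * (1 / μ) := by gcongr
    _ = _ := by ring

/-- The orbit map `x ↦ U(·) x` into bounded continuous functions. -/
noncomputable def orbitMap (U : C0Semigroup H) (M : ℝ) (hU : ∀ t : ℝ≥0, ‖U t‖ ≤ M) :
    H →L[ℂ] (ℝ≥0 →ᵇ H) :=
  LinearMap.mkContinuous
    { toFun := fun x => BoundedContinuousFunction.ofNormedAddCommGroup (fun t => U t x)
        (U.continuous_orbit' x) (M * ‖x‖) fun t => ContinuousLinearMap.le_of_opNorm_le _ (hU t) x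
      map_add' := fun x y => by ext t; simp
      map_smul' := fun c x => by ext t; simp } M fun x =>
    BoundedContinuousFunction.norm_ofNormedAddCommGroup_le _
      (mul_nonneg ((norm_nonneg _).trans (hU 0)) (norm_nonneg _)) fun t =>
        ContinuousLinearMap.le_of_opNorm_le _ (hU t) x

/-- The Duhamel operator on bounded continuous functions. -/
noncomputable def duhamelMap (U : C0Semigroup H) (K : H →L[ℂ] H) {M μ : ℝ}
    (hU : ∀ t : ℝ≥0, ‖U t‖ ≤ M * Real.exp (-μ * t)) (hμ : 0 < μ) :
    (ℝ≥0 →ᵇ H) →L[ℂ] (ℝ≥0 →ᵇ H) :=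
  LinearMap.mkContinuous
    { toFun := fun v => BoundedContinuousFunction.ofNormedAddCommGroup
        (fun t : ℝ≥0 => duhamel U K v t)
        ((continuous_duhamel hU v.continuous).comp NNReal.continuous_coe) (M * ‖K‖ / μ * ‖v‖)
        fun t => norm_duhamel_le hU hμ v.norm_coe_le_norm t.2
      map_add' := fun v w => by
        ext t
        simp only [BoundedContinuousFunction.coe_ofNormedAddCommGroup,
          BoundedContinuousFunction.coe_add, Pi.add_apply, duhamel]
        rw [← intervalIntegral.integral_add
          (intervalIntegrable_duhamelIntegrand hU v.continuous _ _ _)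
          (intervalIntegrable_duhamelIntegrand hU w.continuous _ _ _)]
        simp [duhamelIntegrand]
      map_smul' := fun c v => by
        ext t
        simp [duhamel, duhamelIntegrand, ← intervalIntegral.integral_smul] } (M * ‖K‖ / μ) fun v =>
    BoundedContinuousFunction.norm_ofNormedAddCommGroup_le _
      (mul_nonneg (div_nonneg (mul_nonneg (by simpa using (norm_nonneg _).trans (hU 0))
        (norm_nonneg _)) hμ.le) (norm_nonneg _)) fun t =>
          norm_duhamel_le hU hμ v.norm_coe_le_norm t.2

variable [CompleteSpace H]

/-- Cutting the integral at time s shows that a shifted solution solves the same equation with a new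
initial value; uniqueness then yields the semigroup law. -/
theorem duhamel_add (hU : ∀ t : ℝ≥0, ‖U t‖ ≤ M * Real.exp (-μ * t))
    {v : ℝ≥0 → H} (hv : Continuous v) (t s : ℝ≥0) :
    duhamel U K v (t + s) = U t (duhamel U K v s) + duhamel U K (fun r => v (r + s)) t := by
  have hi := intervalIntegrable_duhamelIntegrand (K := K) hU hv
  unfold duhamel
  rw [← intervalIntegral.integral_add_adjacent_intervals (hi _ 0 s) (hi _ s (t + s))]
  congr 1
  · rw [← ContinuousLinearMap.intervalIntegral_comp_comm _ (hi _ _ _)]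
    refine intervalIntegral.integral_congr fun r hr => ?_
    rw [uIcc_of_le s.coe_nonneg] at hr
    have e : (t + s - r : ℝ) = t + (s - r) := by ring
    simp only [duhamelIntegrand]
    rw [e, Real.toNNReal_add t.coe_nonneg (sub_nonneg.2 hr.2), Real.toNNReal_coe, add_apply]
  · have := intervalIntegral.integral_comp_add_right (a := 0) (b := t)
      (duhamelIntegrand U K v (t + s)) (s : ℝ)
    rw [zero_add] at this
    rw [← this]
    refine intervalIntegral.integral_congr fun r hr => ?_
    rw [uIcc_of_le t.coe_nonneg] at hr
    simp only [duhamelIntegrand]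
    rw [Real.toNNReal_add hr.1 s.coe_nonneg, Real.toNNReal_coe, add_sub_add_right_eq_sub]

/-- The substitution s = h u turns the difference quotient into an integral over [0, 1] that is
continuous in h, also at h = 0. -/
theorem hasDerivWithinAt_duhamel (hU : ∀ t : ℝ≥0, ‖U t‖ ≤ M * Real.exp (-μ * t))
    {v : ℝ≥0 → H} (hv : Continuous v) :
    HasDerivWithinAt (duhamel U K v) (K (v 0)) (Ici 0) 0 := by
  rw [← hasDerivWithinAt_Ioi_iff_Ici, hasDerivWithinAt_iff_tendsto_slope' (by simp)]
  have hc : Continuous fun h : ℝ => ∫ u in (0 : ℝ)..1, duhamelIntegrand U K v h (h * u) := by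
    refine intervalIntegral.continuous_parametric_intervalIntegral_of_continuous' ?_ 0 1
    exact (continuous_duhamelIntegrand hU hv).comp
      (f := fun p : ℝ × ℝ => (p.1, p.1 * p.2)) (by fun_prop)
  have h0 := (hc.tendsto 0).mono_left (nhdsWithin_le_nhds (s := Ioi 0))
  have e0 : ∫ u in (0 : ℝ)..1, duhamelIntegrand U K v 0 (0 * u) = K (v 0) := by
    simp [duhamelIntegrand, U.zero_apply]
  rw [e0] at h0
  refine h0.congr' ?_
  filter_upwards [self_mem_nhdsWithin] with h (hh : 0 < h)
  rw [intervalIntegral.integral_comp_mul_left _ hh.ne']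
  simp [slope, duhamel]

/-- **Bounded perturbation theorem**, for a uniformly exponentially decaying semigroup and a small
perturbation. -/
theorem exists_perturb_of_small {M μ : ℝ} (hU : ∀ t : ℝ≥0, ‖U t‖ ≤ M * Real.exp (-μ * t))
    (hμ : 0 < μ) (hK : M * ‖K‖ / μ ≤ 1 / 2) :
    ∃ T : C0Semigroup H, (∀ t, ‖T t‖ ≤ 2 * M) ∧
      ∀ x y, T.HasGeneratorAt x (y + K x) ↔ U.HasGeneratorAt x y := by
  have hM0 : 0 ≤ M := by have := (norm_nonneg _).trans (hU 0); simpa using this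
  have hU' (t : ℝ≥0) : ‖U t‖ ≤ M := by
    refine (hU t).trans (mul_le_of_le_one_right hM0 (Real.exp_le_one_iff.2 ?_))
    have := t.2
    nlinarith [mul_nonneg hμ.le t.2]
  set J := orbitMap U M hU' with hJ
  set V := duhamelMap U K hU hμ with hV
  have hVn : ‖V‖ ≤ 1 / 2 := (LinearMap.mkContinuous_norm_le _ (by positivity) _).trans hK
  have hJn : ‖J‖ ≤ M := LinearMap.mkContinuous_norm_le _ hM0 _
  have hJa (x : H) (t : ℝ≥0) : J x t = U t x := rfl
  have hVa (v : ℝ≥0 →ᵇ H) (t : ℝ≥0) : V v t = duhamel U K v t := rfl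
  -- Neumann series: since ‖V‖ ≤ 1/2, the equation v = U(·) x + V v has exactly one bounded
  -- continuous solution, `G x`.
  let W := Units.oneSub V (hVn.trans_lt (by norm_num))
  set G : H →L[ℂ] (ℝ≥0 →ᵇ H) := (↑W⁻¹ : (ℝ≥0 →ᵇ H) →L[ℂ] (ℝ≥0 →ᵇ H)).comp J with hG
  have hW (v : ℝ≥0 →ᵇ H) : (W : (ℝ≥0 →ᵇ H) →L[ℂ] (ℝ≥0 →ᵇ H)) v = v - V v := by
    simp [W]
  have hfix (x : H) : G x = J x + V (G x) := by
    have h1 : (W : (ℝ≥0 →ᵇ H) →L[ℂ] (ℝ≥0 →ᵇ H)) (G x) = J x := by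
      exact DFunLike.congr_fun W.mul_inv (J x)
    rw [hW, sub_eq_iff_eq_add] at h1
    exact h1
  have huniq (x : H) (w : ℝ≥0 →ᵇ H) (hw : w = J x + V w) : w = G x := by
    have h1 : (W : (ℝ≥0 →ᵇ H) →L[ℂ] (ℝ≥0 →ᵇ H)) w = J x := by
      rw [hW, sub_eq_iff_eq_add]; exact hw
    rw [hG, ContinuousLinearMap.comp_apply, ← h1]
    exact (DFunLike.congr_fun W.inv_mul w).symm
  have hGn (x : H) : ‖G x‖ ≤ 2 * M * ‖x‖ := by
    have h1 : ‖G x‖ ≤ ‖J x‖ + ‖V (G x)‖ := by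
      conv_lhs => rw [hfix x]
      exact norm_add_le _ _
    have h2 := ContinuousLinearMap.le_of_opNorm_le _ hVn (G x)
    have h3 := ContinuousLinearMap.le_of_opNorm_le _ hJn x
    linarith
  have hfix' (x : H) (t : ℝ≥0) : G x t = U t x + duhamel U K (G x) t := by
    conv_lhs => rw [hfix x]
    rfl
  have hG0 (x : H) : G x 0 = x := by
    rw [hfix']
    simp [duhamel, U.zero_apply]
  let T : C0Semigroup H :=
    { toFun := fun t => (BoundedContinuousFunction.evalCLM ℂ t).comp G
      map_zero' := by ext x; exact hG0 x
      map_add' := fun s t => by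
        ext x
        have := huniq (G x t) ((G x).compContinuous ⟨fun r => r + t, by fun_prop⟩) (by
          ext r
          simp only [BoundedContinuousFunction.compContinuous_apply, ContinuousMap.coe_mk,
            BoundedContinuousFunction.coe_add, Pi.add_apply, hJa, hVa]
          rw [hfix', NNReal.coe_add, duhamel_add hU (G x).continuous, ← add_assoc, U.add_apply,
            ← map_add, ← hfix']
          rfl)
        exact DFunLike.congr_fun this s
      continuous_orbit' := fun x => (G x).continuous }
  have hTa (t : ℝ≥0) (x : H) : T t x = G x t := rfl
  refine ⟨T, fun t => ContinuousLinearMap.opNorm_le_bound _ (by positivity) fun x =>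
    ((G x).norm_coe_le_norm t).trans (hGn x), fun x y => ?_⟩
  -- T(t) x and U(t) x differ by a Duhamel term with right derivative K x at 0, so one orbit is
  -- differentiable there exactly when the other is; hence the domains agree.
  have hd := hasDerivWithinAt_duhamel (K := K) hU (G x).continuous
  rw [hG0] at hd
  have horb : ∀ t ∈ Ici (0 : ℝ), T.orbit x t = U.orbit x t + duhamel U K (G x) t := by
    intro t (ht : 0 ≤ t)
    have := hfix' x t.toNNReal
    rw [Real.coe_toNNReal _ ht] at this
    exact this
  simp only [hasGeneratorAt_iff]
  constructor
  · intro h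
    have := h.sub hd
    rw [add_sub_cancel_right] at this
    exact this.congr (fun t ht => by simp [horb t ht]) (by simp [horb 0 self_mem_Ici])
  · intro h
    exact (h.add hd).congr (fun t ht => by simp [horb t ht]) (by simp [horb 0 self_mem_Ici])

end Duhamel

/-- **Bounded perturbation theorem** with an explicit growth estimate. -/
theorem exists_generator_eq_perturb [CompleteSpace H] (S : C0Semigroup H) {M ω k : ℝ}
    (hM : 1 ≤ M) (hS : ∀ t : ℝ≥0, ‖S t‖ ≤ M * Real.exp (ω * t)) (K : H →L[ℂ] H) (hK : ‖K‖ ≤ k) :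
    ∃ T : C0Semigroup H, T.generator = UnboundedOperator.perturb S.generator K ∧
      ∀ t : ℝ≥0, ‖T t‖ ≤ 2 * M * Real.exp ((ω + 2 * M * (k + 1)) * t) := by
  have hk : 0 ≤ k := (norm_nonneg _).trans hK
  -- Rescaling by ω + μ leaves decay at rate μ, and this μ gives M ‖K‖ / μ ≤ 1/2; k + 1 instead of k
  -- keeps μ positive. The growth estimate depends on K only through k.
  set μ := 2 * M * (k + 1) with hμ
  have hμ0 : 0 < μ := by positivity
  set lam : ℂ := ((ω + μ : ℝ) : ℂ) with hlam
  have hU (t : ℝ≥0) : ‖S.rescale lam t‖ ≤ M * Real.exp (-μ * t) := by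
    refine ContinuousLinearMap.opNorm_le_bound _ (by positivity) fun x => ?_
    rw [norm_rescale, hlam, Complex.ofReal_re]
    calc _ ≤ Real.exp (-(ω + μ) * t) * (M * Real.exp (ω * t) * ‖x‖) := by
          gcongr; exact ContinuousLinearMap.le_of_opNorm_le _ (hS t) x
      _ = M * (Real.exp (-(ω + μ) * t) * Real.exp (ω * t)) * ‖x‖ := by ring
      _ = _ := by rw [← Real.exp_add]; ring_nf
  obtain ⟨T, hT, hTg⟩ := exists_perturb_of_small (K := K) hU hμ0 (by
    rw [div_le_iff₀ hμ0, hμ]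
    nlinarith)
  refine ⟨T.rescale (-lam), generator_eq_iff.2 fun x y => ?_, fun t => ?_⟩
  · rw [hasGeneratorAt_rescale_iff]
    have := hTg x (y + -lam • x - K x)
    rw [sub_add_cancel, hasGeneratorAt_rescale_iff] at this
    rw [this]
    have e : y + -lam • x - K x + lam • x = y - K x := by simp; abel
    rw [e, generator_eq_iff.1 rfl]
    refine exists_congr fun hx => ?_
    rw [eq_sub_iff_add_eq]
    rfl
  · refine ContinuousLinearMap.opNorm_le_bound _ (by positivity) fun x => ?_
    rw [norm_rescale, hlam]
    have := ContinuousLinearMap.le_of_opNorm_le _ (hT t) x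
    simp only [Complex.neg_re, Complex.ofReal_re, neg_neg]
    calc _ ≤ Real.exp ((ω + μ) * t) * (2 * M * ‖x‖) := by gcongr
      _ = _ := by ring

end C0Semigroup

/-! ### Resolvents of unbounded operators. -/

namespace UnboundedOperator

variable {H : Type*} [NormedAddCommGroup H] [NormedSpace ℂ H]
variable {A : H →ₗ.[ℂ] H} {z w : ℂ} {R R' : H →L[ℂ] H}

theorem IsResolventAt.mem (h : IsResolventAt A z R) : z ∈ resolventSet A := ⟨R, h⟩

theorem IsResolventAt.unique (h : IsResolventAt A z R) (h' : IsResolventAt A z R') : R = R' := by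
  ext x
  obtain ⟨hx, e⟩ := h'.1 x
  have := h.2 ⟨R' x, hx⟩
  rw [e] at this
  exact this

theorem isResolventAt_resolvent (hz : z ∈ resolventSet A) : IsResolventAt A z (resolvent A z) := by
  have hz' : ∃ R, IsResolventAt A z R := hz
  rw [resolvent, dif_pos hz']
  exact hz'.choose_spec

theorem IsResolventAt.resolvent_eq (h : IsResolventAt A z R) : resolvent A z = R :=
  (isResolventAt_resolvent h.mem).unique h

theorem resolvent_of_eq (hz : z ∈ resolventSet A) {x y : H} (hx : x ∈ A.domain)
    (h : z • x - A ⟨x, hx⟩ = y) : resolvent A z y = x := by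
  rw [← h]
  exact (isResolventAt_resolvent hz).2 ⟨x, hx⟩

theorem resolvent_injective (hz : z ∈ resolventSet A) : Function.Injective (resolvent A z) := by
  intro x y hxy
  obtain ⟨hx, e⟩ := (isResolventAt_resolvent hz).1 x
  obtain ⟨hy, e'⟩ := (isResolventAt_resolvent hz).1 y
  rw [← e, ← e']
  congr 1
  · rw [hxy]
  · congr 2

/-- If `(z I - A) x = y` then `x = R_A(w) (y + (w - z) x)`. -/
theorem eq_resolvent_add (hw : w ∈ resolventSet A) {x y : H} (hx : x ∈ A.domain)
    (h : z • x - A ⟨x, hx⟩ = y) : x = resolvent A w y + (w - z) • resolvent A w x := by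
  rw [← map_smul, ← map_add]
  refine (resolvent_of_eq hw hx ?_).symm
  rw [← h, sub_smul]
  abel

/-- The resolvent identity. -/
theorem resolvent_sub_resolvent (hz : z ∈ resolventSet A) (hw : w ∈ resolventSet A) :
    resolvent A z - resolvent A w = (w - z) • (resolvent A w * resolvent A z) := by
  ext x
  obtain ⟨hx, e⟩ := (isResolventAt_resolvent hz).1 x
  have := eq_resolvent_add hw hx e
  simp only [_root_.sub_apply, _root_.smul_apply]
  rw [sub_eq_iff_eq_add, add_comm]
  exact this

theorem resolvent_commute (hz : z ∈ resolventSet A) (hw : w ∈ resolventSet A) :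
    Commute (resolvent A z) (resolvent A w) := by
  by_cases h : z = w
  · rw [h]
  have h1 := resolvent_sub_resolvent hz hw
  have h2 := resolvent_sub_resolvent hw hz
  have h3 : (w - z) • (resolvent A z * resolvent A w) = (w - z) • (resolvent A w * resolvent A z) := by
    rw [← h1, ← neg_sub (resolvent A w), h2, ← neg_smul, neg_sub]
  exact smul_right_injective _ (sub_ne_zero.2 (Ne.symm h)) h3

/-- Stability of the resolvent set under bounded perturbations. -/
theorem IsResolventAt.perturb (h : IsResolventAt A z R) {K : H →L[ℂ] H} (hu : IsUnit (1 - K * R)) :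
    IsResolventAt (perturb A K) z (R * Ring.inverse (1 - K * R)) := by
  constructor
  · intro x
    set y := Ring.inverse (1 - K * R) x with hy
    have hyx : y - K (R y) = x := by
      have := DFunLike.congr_fun (Ring.mul_inverse_cancel _ hu) x
      simpa using this
    obtain ⟨hd, e⟩ := h.1 y
    refine ⟨hd, ?_⟩
    change z • R y - (A ⟨R y, hd⟩ + K (R y)) = x
    rw [← hyx, ← sub_sub, e]
  · intro (x : A.domain)
    have e := h.2 x
    change R (Ring.inverse (1 - K * R) (z • (x : H) - (A x + K x))) = x
    have e2 : z • (x : H) - (A x + K x) = (1 - K * R) (z • (x : H) - A x) := by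
      simp only [_root_.sub_apply, one_apply_eq_self,
        mul_apply_eq_comp, e, sub_sub]
    have := DFunLike.congr_fun (Ring.inverse_mul_cancel _ hu) (z • (x : H) - A x)
    rw [e2]
    simp only [one_apply_eq_self, mul_apply_eq_comp] at this
    rw [this, e]

/-- The identities R' = R + R K R' and R' = R + R' K R exhibit 1 + K R' as a two-sided inverse of 1
- K R. -/
theorem isUnit_of_mem_resolventSet_perturb {K : H →L[ℂ] H} (hz : z ∈ resolventSet A)
    (hz' : z ∈ resolventSet (perturb A K)) : IsUnit (1 - K * resolvent A z) := by
  set R := resolvent A z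
  set R' := resolvent (perturb A K) z
  have h : R' = R + R * (K * R') := by
    ext x
    obtain ⟨hd, e⟩ := (isResolventAt_resolvent hz').1 x
    have e' : z • R' x - A ⟨R' x, hd⟩ = x + K (R' x) := by
      have e1 : z • R' x - (A ⟨R' x, hd⟩ + K (R' x)) = x := e
      rw [← sub_sub, sub_eq_iff_eq_add] at e1
      exact e1
    have := resolvent_of_eq hz hd e'
    rw [map_add] at this
    exact this.symm
  have h' : R' = R + R' * (K * R) := by
    ext x
    obtain ⟨hd, e⟩ := (isResolventAt_resolvent hz).1 x
    have e' : z • R x - perturb A K ⟨R x, hd⟩ = x - K (R x) := by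
      change z • R x - (A ⟨R x, hd⟩ + K (R x)) = _
      rw [← sub_sub, e]
    have := resolvent_of_eq hz' hd e'
    rw [map_sub, sub_eq_iff_eq_add] at this
    exact this
  refine ⟨⟨1 - K * R, 1 + K * R', ?_, ?_⟩, rfl⟩
  · have : K * R' = K * R + K * R * (K * R') := by
      conv_lhs => rw [h]
      noncomm_ring
    calc (1 - K * R) * (1 + K * R') = 1 + (K * R' - (K * R + K * R * (K * R'))) := by noncomm_ring
      _ = 1 := by rw [← this, sub_self, add_zero]
  · have : K * R' = K * R + K * R' * (K * R) := by
      conv_lhs => rw [h']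
      noncomm_ring
    calc (1 + K * R') * (1 - K * R) = 1 + (K * R' - (K * R + K * R' * (K * R))) := by noncomm_ring
      _ = 1 := by rw [← this, sub_self, add_zero]

theorem eventually_norm_sub_smul_lt (w : ℂ) (T : H →L[ℂ] H) : ∀ᶠ z in 𝓝 w, ‖(w - z) • T‖ < 1 := by
  have : Continuous fun z : ℂ => ‖(w - z) • T‖ := by fun_prop
  have := this.tendsto w
  simp only [sub_self, zero_smul, norm_zero] at this
  exact this.eventually (gt_mem_nhds one_pos)

variable [CompleteSpace H]

/-- Moving the spectral parameter is a bounded perturbation: z - A = w - (A + (w - z) I). -/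
theorem isResolventAt_of_norm_lt (hw : w ∈ resolventSet A) (hz : ‖(w - z) • resolvent A w‖ < 1) :
    IsResolventAt A z (resolvent A w * Ring.inverse (1 - (w - z) • resolvent A w)) := by
  have hu := isUnit_one_sub_of_norm_lt_one hz
  have h := isResolventAt_resolvent hw
  have h1 := h.perturb (K := (w - z) • 1) (by simpa using hu)
  simp only [smul_mul_assoc, one_mul] at h1
  refine ⟨fun x => ?_, fun x => ?_⟩
  · obtain ⟨hd, e⟩ := h1.1 x
    refine ⟨hd, ?_⟩
    set y := (resolvent A w * Ring.inverse (1 - (w - z) • resolvent A w)) x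
    have e1 : w • y - (A ⟨y, hd⟩ + (w - z) • y) = x := e
    calc z • y - A ⟨y, hd⟩ = w • y - (A ⟨y, hd⟩ + (w - z) • y) := by rw [sub_smul]; abel
      _ = x := e1
  · have := h1.2 x
    change (resolvent A w * Ring.inverse (1 - (w - z) • resolvent A w))
      (w • (x : H) - (A x + (w - z) • (x : H))) = x at this
    have e : w • (x : H) - (A x + (w - z) • (x : H)) = z • (x : H) - A x := by
      rw [sub_smul]; abel
    rwa [e] at this

theorem isOpen_resolventSet (A : H →ₗ.[ℂ] H) : IsOpen (resolventSet A) := by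
  rw [isOpen_iff_mem_nhds]
  intro w hw
  filter_upwards [eventually_norm_sub_smul_lt w (resolvent A w)] with z hz
  exact (isResolventAt_of_norm_lt hw hz).mem

theorem isClosed_spec (A : H →ₗ.[ℂ] H) : IsClosed (spec A) :=
  (isOpen_resolventSet A).isClosed_compl

theorem analyticAt_resolvent (hw : w ∈ resolventSet A) : AnalyticAt ℂ (resolvent A) w := by
  have h : (fun z => resolvent A w * Ring.inverse (1 - (w - z) • resolvent A w)) =ᶠ[𝓝 w]
      resolvent A := by
    filter_upwards [eventually_norm_sub_smul_lt w (resolvent A w)] with z hz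
    exact (isResolventAt_of_norm_lt hw hz).resolvent_eq.symm
  refine AnalyticAt.congr ?_ h
  refine analyticAt_const.mul ?_
  refine AnalyticAt.fun_comp (g := Ring.inverse) ?_ ?_
  · have : 1 - (w - w) • resolvent A w = ((1 : (H →L[ℂ] H)ˣ) : H →L[ℂ] H) := by simp
    rw [this]
    exact analyticAt_inverse _
  · fun_prop

theorem continuousOn_resolvent (A : H →ₗ.[ℂ] H) : ContinuousOn (resolvent A) (resolventSet A) :=
  fun _ hw => (analyticAt_resolvent hw).continuousAt.continuousWithinAt

end UnboundedOperator

/-! ### The resolvent of a generator as a Laplace transform. -/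

namespace C0Semigroup

open MeasureTheory Set

variable {H : Type*} [NormedAddCommGroup H] [NormedSpace ℂ H]

/-- The Laplace transform `∫₀^∞ e^{-zt} S(t) x dt` of an orbit. -/
noncomputable def laplace (S : C0Semigroup H) (z : ℂ) (x : H) : H :=
  ∫ t in Ioi (0 : ℝ), (S.rescale z).orbit x t

variable {S : C0Semigroup H} {x : H} {N ω : ℝ} {z : ℂ}

theorem norm_rescale_orbit_le (hx : ∀ t : ℝ≥0, ‖S t x‖ ≤ N * Real.exp (ω * t)) {t : ℝ}
    (ht : 0 ≤ t) : ‖(S.rescale z).orbit x t‖ ≤ N * Real.exp (-(z.re - ω) * t) := by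
  rw [orbit, norm_rescale]
  have := hx t.toNNReal
  rw [Real.coe_toNNReal _ ht] at this ⊢
  calc _ ≤ Real.exp (-z.re * t) * (N * Real.exp (ω * t)) := by gcongr
    _ = N * (Real.exp (-z.re * t) * Real.exp (ω * t)) := by ring
    _ = _ := by rw [← Real.exp_add]; ring_nf

theorem integrableOn_rescale_orbit (hx : ∀ t : ℝ≥0, ‖S t x‖ ≤ N * Real.exp (ω * t))
    (hz : ω < z.re) : IntegrableOn ((S.rescale z).orbit x) (Ioi 0) := by
  have h1 := (integrableOn_exp_mul_Ioi (a := -(z.re - ω)) (by linarith) 0).const_mul N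
  refine h1.mono' ((S.rescale z).continuous_orbit x).aestronglyMeasurable ?_
  filter_upwards [self_mem_ae_restrict measurableSet_Ioi] with t (ht : 0 < t)
  exact norm_rescale_orbit_le hx ht.le

theorem norm_laplace_le (hx : ∀ t : ℝ≥0, ‖S t x‖ ≤ N * Real.exp (ω * t))
    (hz : ω < z.re) : ‖S.laplace z x‖ ≤ N / (z.re - ω) := by
  have h1 := (integrableOn_exp_mul_Ioi (a := -(z.re - ω)) (by linarith) 0).const_mul N
  have h2 := norm_integral_le_of_norm_le h1 (f := (S.rescale z).orbit x) (by
    filter_upwards [self_mem_ae_restrict measurableSet_Ioi] with t (ht : 0 < t)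
    exact norm_rescale_orbit_le hx ht.le)
  rw [integral_const_mul, integral_exp_mul_Ioi (by linarith)] at h2
  refine h2.trans_eq ?_
  have : z.re - ω ≠ 0 := by linarith
  simp only [mul_zero, Real.exp_zero]
  field_simp

variable [CompleteSpace H]

theorem hasGeneratorAt_laplace (hx : ∀ t : ℝ≥0, ‖S t x‖ ≤ N * Real.exp (ω * t))
    (hz : ω < z.re) : S.HasGeneratorAt (S.laplace z x) (z • S.laplace z x - x) := by
  have := hasGeneratorAt_rescale_iff.1
    (hasGeneratorAt_integral_Ioi _ x (integrableOn_rescale_orbit hx hz))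
  rw [neg_add_eq_sub] at this
  exact this

/-- Only the orbit of x has to grow at rate ω: z may lie to the left of the growth bound of S. This
is what makes the formula usable on the range of I - P. -/
theorem resolvent_eq_laplace (hx : ∀ t : ℝ≥0, ‖S t x‖ ≤ N * Real.exp (ω * t))
    (hz : ω < z.re) (hρ : z ∈ UnboundedOperator.resolventSet S.generator) :
    UnboundedOperator.resolvent S.generator z x = S.laplace z x := by
  have := hasGeneratorAt_laplace hx hz
  refine UnboundedOperator.resolvent_of_eq hρ ⟨_, this⟩ ?_
  rw [this.generator_apply]
  abel

variable {M : ℝ} (hS : ∀ t : ℝ≥0, ‖S t‖ ≤ M * Real.exp (ω * t)) (hz : ω < z.re)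
include hS hz

/-- The Laplace transform is a bounded right inverse of z - L, and also a left inverse because it
commutes with the semigroup and hence with the generator. -/
theorem mem_resolventSet_generator : z ∈ UnboundedOperator.resolventSet S.generator := by
  have hM0 : 0 ≤ M := by have := (norm_nonneg _).trans (hS 0); simpa using this
  have hb (x : H) (t : ℝ≥0) : ‖S t x‖ ≤ M * ‖x‖ * Real.exp (ω * t) :=
    (ContinuousLinearMap.le_of_opNorm_le _ (hS t) x).trans_eq (by ring)
  have hi (x : H) := integrableOn_rescale_orbit (hb x) hz
  let R : H →L[ℂ] H := LinearMap.mkContinuous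
    { toFun := S.laplace z
      map_add' := fun x y => by
        rw [laplace, laplace, laplace, ← integral_add (hi x) (hi y)]
        simp [orbit]
      map_smul' := fun c x => by
        rw [laplace, laplace, RingHom.id_apply, ← integral_smul]
        simp [orbit] } (M / (z.re - ω)) fun x => by
    refine (norm_laplace_le (hb x) hz).trans_eq ?_
    ring
  have hR (x : H) : R x = S.laplace z x := rfl
  have hg (x : H) : S.HasGeneratorAt (R x) (z • R x - x) := hasGeneratorAt_laplace (hb x) hz
  refine ⟨R, fun x => ⟨⟨_, hg x⟩, ?_⟩, fun x => ?_⟩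
  · rw [(hg x).generator_apply]
    abel
  · have h1 := S.hasGeneratorAt_generator x
    set y := S.generator x
    have h2 : S.HasGeneratorAt (R x) (R y) := by
      refine ((R.continuous.tendsto y).comp h1).congr fun t => ?_
      simp only [Function.comp, map_smul, map_sub]
      congr 2
      rw [hR, hR, laplace, laplace, ← ContinuousLinearMap.integral_comp_comm _ (hi x)]
      refine integral_congr_ae (ae_of_all _ fun s => ?_)
      simp only [orbit, rescale_apply, map_smul]
      rw [S.comm_apply]
    have h3 := (hg x).unique h2
    rw [map_sub, map_smul, ← h3]
    abel

theorem norm_resolvent_generator_le :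
    ‖UnboundedOperator.resolvent S.generator z‖ ≤ M / (z.re - ω) := by
  have hM0 : 0 ≤ M := by have := (norm_nonneg _).trans (hS 0); simpa using this
  refine ContinuousLinearMap.opNorm_le_bound _ (div_nonneg hM0 (by linarith)) fun x => ?_
  have hb (t : ℝ≥0) : ‖S t x‖ ≤ M * ‖x‖ * Real.exp (ω * t) :=
    (ContinuousLinearMap.le_of_opNorm_le _ (hS t) x).trans_eq (by ring)
  rw [resolvent_eq_laplace hb hz (mem_resolventSet_generator hS hz)]
  refine (norm_laplace_le hb hz).trans_eq ?_
  ring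

end C0Semigroup

/-! ### Finite-rank approximation of compact operators. -/

open Bornology Set

section CompactApproximation

variable {H : Type*} [NormedAddCommGroup H] [InnerProductSpace ℂ H]

/-- Compact operators into a Hilbert space are norm limits of operators of finite rank. -/
theorem IsCompactOperator.exists_finiteDimensional_approx {K : H →L[ℂ] H}
    (hK : IsCompactOperator K) {ε : ℝ} (hε : 0 < ε) :
    ∃ (V : Submodule ℂ H) (_ : FiniteDimensional ℂ V) (g : H →L[ℂ] V),
      ‖K - V.subtypeL.comp g‖ ≤ ε := by
  have h1 : TotallyBounded (K '' Metric.closedBall 0 1) :=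
    (hK.isCompact_closure_image_closedBall (f := (K : H →ₗ[ℂ] H)) 1).totallyBounded.subset
      subset_closure
  obtain ⟨t, ht, hcov⟩ := Metric.totallyBounded_iff.1 h1 ε hε
  let V := Submodule.span ℂ t
  have hV : FiniteDimensional ℂ V := FiniteDimensional.span_of_finite ℂ ht
  -- V is spanned by a finite ε-net of the image of the unit ball; the orthogonal projection of K x
  -- is at least as close to K x as the nearest net point.
  refine ⟨V, hV, V.orthogonalProjectionOnto.comp K, ?_⟩
  refine ContinuousLinearMap.opNorm_le_of_unit_norm hε.le fun x hx => ?_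
  have hx' : K x ∈ K '' Metric.closedBall 0 1 := ⟨x, by simp [hx], rfl⟩
  obtain ⟨y, hy, hxy⟩ := mem_iUnion₂.1 (hcov hx')
  have h2 := V.starProjection_minimal (K x)
  have h3 : ⨅ w : V, ‖K x - w‖ ≤ ‖K x - y‖ :=
    ciInf_le ⟨0, by rintro _ ⟨w, rfl⟩; positivity⟩ (⟨y, Submodule.subset_span hy⟩ : V)
  rw [← h2] at h3
  refine le_trans ?_ (h3.trans (by rw [← dist_eq_norm]; exact (Metric.mem_ball.1 hxy).le))
  exact le_of_eq rfl

/-- In finite dimension this upgrades convergence at the basis vectors to convergence in operator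
norm. -/
theorem ContinuousLinearMap.opNorm_le_sum_basis {V W ι : Type*} [Fintype ι] [NormedAddCommGroup V]
    [InnerProductSpace ℂ V] [NormedAddCommGroup W] [NormedSpace ℂ W] (b : OrthonormalBasis ι ℂ V)
    (T : V →L[ℂ] W) : ‖T‖ ≤ ∑ i, ‖T (b i)‖ := by
  refine T.opNorm_le_bound (Finset.sum_nonneg fun _ _ => norm_nonneg _) fun x => ?_
  conv_lhs => rw [← b.sum_repr x, map_sum]
  rw [Finset.sum_mul]
  refine norm_sum_le_of_le _ fun i _ => ?_
  rw [map_smul, norm_smul, mul_comm, b.repr_apply_apply]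
  gcongr
  exact (norm_inner_le_norm _ _).trans (by simp)

end CompactApproximation

/-! ### Decay of K R(z) and the spectrum of the perturbed generator. -/

namespace C0Semigroup

open UnboundedOperator hiding resolvent resolventSet

variable {H : Type*} [NormedAddCommGroup H] [InnerProductSpace ℂ H] [CompleteSpace H]
variable {S : C0Semigroup H} {M ω a : ℝ}

/-- Neighbourhoods of infinity in the half-plane `Re z ≥ a`. -/
noncomputable def atInftyRight (a : ℝ) : Filter ℂ := cobounded ℂ ⊓ 𝓟 {z | a ≤ z.re}

theorem norm_resolvent_generator_le_of_le (hS : ∀ t : ℝ≥0, ‖S t‖ ≤ M * Real.exp (ω * t))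
    (ha : ω < a) {z : ℂ} (hz : a ≤ z.re) : ‖UnboundedOperator.resolvent S.generator z‖ ≤ M / (a - ω) := by
  have hM0 : 0 ≤ M := by have := (norm_nonneg _).trans (hS 0); simpa using this
  refine (norm_resolvent_generator_le hS (ha.trans_le hz)).trans ?_
  have : 0 < a - ω := by linarith
  gcongr

-- On the range of R(a)* the resolvent identity gives decay of order 1/|z - a|. That range is dense
-- because R(a) is injective, and the uniform bound on R(z) carries the limit to every vector.
open ContinuousLinearMap in
theorem tendsto_adjoint_resolvent (hS : ∀ t : ℝ≥0, ‖S t‖ ≤ M * Real.exp (ω * t)) (ha : ω < a)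
    (v : H) : Tendsto (fun z => adjoint (UnboundedOperator.resolvent S.generator z) v) (atInftyRight a) (𝓝 0) := by
  set R := UnboundedOperator.resolvent S.generator
  set C := M / (a - ω) with hC
  have hC0 : 0 ≤ C := (norm_nonneg _).trans
    (norm_resolvent_generator_le_of_le hS ha (z := a) (by simp))
  have hmem : ∀ᶠ z in atInftyRight a, a ≤ z.re := mem_inf_of_right (mem_principal_self _)
  have hRC : ∀ᶠ z in atInftyRight a, ‖R z‖ ≤ C := by
    filter_upwards [hmem] with z hz using norm_resolvent_generator_le_of_le hS ha hz
  have haρ : (a : ℂ) ∈ UnboundedOperator.resolventSet S.generator := mem_resolventSet_generator hS (by simpa using ha)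
  have hdense : Dense (Set.range (adjoint (R a))) := by
    have h1 : (LinearMap.range (adjoint (R a) : H →ₗ[ℂ] H))ᗮ = ⊥ := by
      have := ContinuousLinearMap.orthogonal_range (adjoint (R a))
      rw [adjoint_adjoint] at this
      rw [this]
      exact LinearMap.ker_eq_bot.2 (resolvent_injective haρ)
    have h2 := Submodule.topologicalClosure_eq_top_iff.2 h1
    have h3 := Submodule.dense_iff_topologicalClosure_eq_top.2 h2
    exact h3
  have hsmall : ∀ v ∈ Set.range (adjoint (R a)),
      Tendsto (fun z => adjoint (R z) v) (atInftyRight a) (𝓝 0) := by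
    rintro _ ⟨u, rfl⟩
    have h0 : Tendsto (fun z : ℂ => ‖z - a‖⁻¹ * ((C + C) * ‖u‖)) (atInftyRight a) (𝓝 0) := by
      have h1 : Tendsto (fun z : ℂ => ‖z - a‖) (atInftyRight a) atTop := by
        refine Tendsto.mono_left ?_ inf_le_left
        refine tendsto_atTop_mono (f := fun z : ℂ => ‖z‖ - ‖(a : ℂ)‖)
          (fun z => norm_sub_norm_le _ _) ?_
        exact tendsto_atTop_add_const_right _ _ tendsto_norm_cobounded_atTop
      simpa using h1.inv_tendsto_atTop.mul_const ((C + C) * ‖u‖)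
    refine squeeze_zero_norm' ?_ h0
    have hne : ∀ᶠ z : ℂ in atInftyRight a, z ≠ (a : ℂ) := by
      refine mem_inf_of_left ?_
      exact eventually_ne_cobounded _
    filter_upwards [hmem, hne] with z hz hza
    have hzρ : z ∈ UnboundedOperator.resolventSet S.generator := mem_resolventSet_generator hS (ha.trans_le hz)
    have e : R a * R z = (z - a)⁻¹ • (R a - R z) := by
      rw [resolvent_sub_resolvent haρ hzρ, smul_smul, inv_mul_cancel₀ (sub_ne_zero.2 hza), one_smul,
        (resolvent_commute haρ hzρ).eq]
    have e2 : adjoint (R z) (adjoint (R a) u) = adjoint (R a * R z) u := by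
      change _ = adjoint ((R a).comp (R z)) u
      rw [adjoint_comp]; rfl
    rw [e2]
    refine ((adjoint (R a * R z)).le_opNorm u).trans ?_
    rw [LinearIsometryEquiv.norm_map, e, norm_smul, norm_inv, mul_assoc]
    gcongr
    exact (norm_sub_le _ _).trans (add_le_add
      (norm_resolvent_generator_le_of_le hS ha (by simp)) (norm_resolvent_generator_le_of_le hS ha hz))
  rw [Metric.tendsto_nhds]
  intro ε hε
  obtain ⟨w, hw, hvw⟩ := hdense.exists_dist_lt v (ε := ε / (2 * (C + 1))) (by positivity)
  filter_upwards [hRC, Metric.tendsto_nhds.1 (hsmall w hw) (ε / 2) (by positivity)] with z hz hzw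
  rw [dist_zero_right] at hzw ⊢
  have e : adjoint (R z) v = adjoint (R z) (v - w) + adjoint (R z) w := by simp
  rw [e]
  have h1 : ‖adjoint (R z) (v - w)‖ ≤ C * (ε / (2 * (C + 1))) := by
    have hvw' : ‖v - w‖ ≤ ε / (2 * (C + 1)) := by rw [← dist_eq_norm]; exact hvw.le
    refine (le_opNorm_of_le _ hvw').trans ?_
    rw [LinearIsometryEquiv.norm_map]
    exact mul_le_mul_of_nonneg_right hz (by positivity)
  have h2 : C * (ε / (2 * (C + 1))) ≤ ε / 2 := by
    rw [mul_div_assoc', div_le_div_iff₀ (by positivity) (by positivity)]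
    nlinarith
  calc _ ≤ _ := norm_add_le _ _
    _ < ε := by linarith

-- Pointwise decay of the adjoints suffices for finite rank: ‖g R(z)‖ = ‖R(z)* g*‖, and g* is
-- determined by finitely many vectors.
open ContinuousLinearMap in
theorem tendsto_finiteRank_mul_resolvent (hS : ∀ t : ℝ≥0, ‖S t‖ ≤ M * Real.exp (ω * t))
    (ha : ω < a) {V : Submodule ℂ H} [FiniteDimensional ℂ V] (g : H →L[ℂ] V) :
    Tendsto (fun z => ‖g.comp (UnboundedOperator.resolvent S.generator z)‖) (atInftyRight a) (𝓝 0) := by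
  let b := stdOrthonormalBasis ℂ V
  have h : Tendsto (fun z => ∑ i, ‖adjoint (UnboundedOperator.resolvent S.generator z) (adjoint g (b i))‖)
      (atInftyRight a) (𝓝 0) := by
    have := tendsto_finsetSum Finset.univ fun i _ => (tendsto_adjoint_resolvent hS ha (adjoint g (b i))).norm
    simpa using this
  refine squeeze_zero (fun _ => opNorm_nonneg _) (fun z => ?_) h
  have e : ‖g.comp (UnboundedOperator.resolvent S.generator z)‖ =
      ‖(adjoint (UnboundedOperator.resolvent S.generator z)).comp (adjoint g)‖ := by
    rw [← adjoint_comp g (UnboundedOperator.resolvent S.generator z)]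
    exact (LinearIsometryEquiv.norm_map adjoint
      (g.comp (UnboundedOperator.resolvent S.generator z))).symm
  rw [e]
  exact opNorm_le_sum_basis b
    ((adjoint (UnboundedOperator.resolvent S.generator z)).comp (adjoint g))

/-- `‖K R(z)‖ → 0` as `z → ∞` in a half-plane, uniformly for `K` in a compact set of compact
operators. -/
theorem eventually_norm_mul_resolvent_lt (hS : ∀ t : ℝ≥0, ‖S t‖ ≤ M * Real.exp (ω * t))
    (ha : ω < a) {𝒦 : Set (H →L[ℂ] H)} (h𝒦 : IsCompact 𝒦) (hcomp : ∀ K ∈ 𝒦, IsCompactOperator K)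
    {ε : ℝ} (hε : 0 < ε) :
    ∀ᶠ z in atInftyRight a, ∀ K ∈ 𝒦, ‖K * UnboundedOperator.resolvent S.generator z‖ < ε := by
  set R := UnboundedOperator.resolvent S.generator
  set C := M / (a - ω) with hC
  have hC0 : 0 ≤ C := (norm_nonneg _).trans
    (norm_resolvent_generator_le_of_le hS ha (z := a) (by simp))
  have hRC : ∀ᶠ z in atInftyRight a, ‖R z‖ ≤ C := by
    filter_upwards [mem_inf_of_right (mem_principal_self _)] with z hz using
      norm_resolvent_generator_le_of_le hS ha hz
  -- A quarter of ε each pays for the δ-net of 𝒦, for the finite-rank approximation of its points,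
  -- and for the finite-rank part times R(z).
  set δ := ε / (4 * (C + 1)) with hδ
  have hδ0 : 0 < δ := by positivity
  have hδC : δ * C ≤ ε / 4 := by
    rw [hδ, div_mul_eq_mul_div, div_le_div_iff₀ (by positivity) (by positivity)]
    nlinarith
  obtain ⟨t, ht𝒦, ht, hcov⟩ := h𝒦.finite_cover_balls hδ0
  have h1 : ∀ᶠ z in atInftyRight a, ∀ K ∈ t, ‖K * R z‖ < ε / 2 := by
    rw [eventually_all_finite ht]
    intro K hKt
    obtain ⟨V, hV, g, hg⟩ := (hcomp K (ht𝒦 hKt)).exists_finiteDimensional_approx hδ0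
    have := (tendsto_finiteRank_mul_resolvent hS ha g).eventually
      (gt_mem_nhds (show (0 : ℝ) < ε / 4 by positivity))
    filter_upwards [hRC, this] with z hz hgz
    have e : K * R z = (K - V.subtypeL.comp g) * R z + V.subtypeL.comp (g.comp (R z)) := by
      rw [sub_mul]
      exact (sub_add_cancel _ _).symm
    rw [e]
    have h3 : ‖V.subtypeL.comp (g.comp (R z))‖ ≤ ‖g.comp (R z)‖ :=
      (ContinuousLinearMap.opNorm_comp_le _ _).trans
        (mul_le_of_le_one_left (norm_nonneg _) V.norm_subtypeL_le)
    have h2 : ‖(K - V.subtypeL.comp g) * R z‖ ≤ δ * C :=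
      (norm_mul_le _ _).trans (by gcongr)
    calc _ ≤ _ := norm_add_le _ _
      _ < ε / 2 := by linarith
  filter_upwards [hRC, h1] with z hz hzt K hK
  obtain ⟨K', hK', hd⟩ := mem_iUnion₂.1 (hcov hK)
  have e : K * R z = (K - K') * R z + K' * R z := by rw [sub_mul]; abel
  have h2 : ‖(K - K') * R z‖ ≤ δ * C := by
    refine (norm_mul_le _ _).trans ?_
    rw [Metric.mem_ball, dist_eq_norm] at hd
    gcongr
  rw [e]
  calc _ ≤ _ := norm_add_le _ _
    _ < ε := by linarith [hzt K' hK']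

variable {K : H →L[ℂ] H} {z : ℂ}

theorem mem_resolventSet_perturb_of_isUnit (hS : ∀ t : ℝ≥0, ‖S t‖ ≤ M * Real.exp (ω * t))
    (hz : ω < z.re) (hu : IsUnit (1 - K * UnboundedOperator.resolvent S.generator z)) :
    z ∈ UnboundedOperator.resolventSet (perturb S.generator K) :=
  ((isResolventAt_resolvent (mem_resolventSet_generator hS hz)).perturb hu).mem

/-- Fredholm alternative for the compact operator K R(z): if 1 - K R(z) is not invertible, then 1 is
an eigenvalue. -/
theorem exists_fixed_of_mem_spec (hS : ∀ t : ℝ≥0, ‖S t‖ ≤ M * Real.exp (ω * t))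
    (hK : IsCompactOperator K) (hz : ω < z.re) (hσ : z ∈ spec (perturb S.generator K)) :
    ∃ u : H, u ≠ 0 ∧ K (UnboundedOperator.resolvent S.generator z u) = u := by
  have hc : IsCompactOperator (K * UnboundedOperator.resolvent S.generator z) := hK.comp_clm _
  rcases hc.hasEigenvalue_or_mem_resolventSet (one_ne_zero (α := ℂ)) with h | h
  · obtain ⟨u, hu⟩ := h.exists_hasEigenvector
    refine ⟨u, hu.2, ?_⟩
    have := hu.apply_eq_smul
    rw [one_smul] at this
    exact this
  · refine absurd (mem_resolventSet_perturb_of_isUnit hS hz ?_) hσ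
    have := spectrum.mem_resolventSet_iff.1 h
    simpa using this

/-- Spectral points of the perturbed generator to the right of the growth bound are eigenvalues. -/
theorem exists_eigenvector_of_mem_spec (hS : ∀ t : ℝ≥0, ‖S t‖ ≤ M * Real.exp (ω * t))
    (hK : IsCompactOperator K) (hz : ω < z.re) (hσ : z ∈ spec (perturb S.generator K)) :
    ∃ x : H, x ≠ 0 ∧ ∃ hx : x ∈ (perturb S.generator K).domain,
      perturb S.generator K ⟨x, hx⟩ = z • x := by
  obtain ⟨u, hu0, hu⟩ := exists_fixed_of_mem_spec hS hK hz hσ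
  have hρ := mem_resolventSet_generator hS hz
  obtain ⟨hd, e⟩ := (isResolventAt_resolvent hρ).1 u
  refine ⟨UnboundedOperator.resolvent S.generator z u, fun h => hu0 ?_, hd, ?_⟩
  · exact resolvent_injective hρ (by rw [h, map_zero])
  · change S.generator ⟨_, hd⟩ + K (UnboundedOperator.resolvent S.generator z u) = _
    rw [hu]
    nth_rewrite 2 [← e]
    abel

/-- To the right of the growth bound, the spectrum of a compactly perturbed generator is discrete. -/
theorem eventually_mem_resolventSet_perturb (hS : ∀ t : ℝ≥0, ‖S t‖ ≤ M * Real.exp (ω * t))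
    (hK : IsCompactOperator K) (hz : ω < z.re) :
    ∀ᶠ w in 𝓝[≠] z, w ∈ UnboundedOperator.resolventSet (perturb S.generator K) := by
  obtain ⟨a, ha, haz⟩ := exists_between hz
  set R := UnboundedOperator.resolvent S.generator with hR
  set C := M / (a - ω) with hC
  have hC0 : 0 ≤ C := (norm_nonneg _).trans
    (norm_resolvent_generator_le_of_le hS ha (z := a) (by simp))
  -- This accuracy makes ‖(K - ι g) R(w)‖ < 1 on U, so E(w) below is invertible and only the
  -- finite-rank part can obstruct invertibility.
  obtain ⟨V, hV, g, hg⟩ := hK.exists_finiteDimensional_approx (ε := 1 / (2 * (C + 1))) (by positivity)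
  set ι := V.subtypeL with hι
  set U : Set ℂ := {w | a < w.re} with hU
  have hUρ : ∀ w ∈ U, w ∈ UnboundedOperator.resolventSet S.generator := fun w hw =>
    mem_resolventSet_generator hS (ha.trans hw)
  have hUR : ∀ w ∈ U, ‖R w‖ ≤ C := fun w (hw : a < w.re) =>
    norm_resolvent_generator_le_of_le hS ha hw.le
  let E : ℂ → H →L[ℂ] H := fun w => 1 - (K - ι.comp g) * R w
  have hE : ∀ w ∈ U, IsUnit (E w) := by
    intro w hw
    refine isUnit_one_sub_of_norm_lt_one ?_
    calc _ ≤ 1 / (2 * (C + 1)) * C := (norm_mul_le _ _).trans (by gcongr; exact hUR w hw)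
      _ < 1 := by rw [div_mul_eq_mul_div, div_lt_one (by positivity)]; linarith
  let h : ℂ → H →L[ℂ] V := fun w => g.comp (R w * Ring.inverse (E w))
  let D : ℂ → V →L[ℂ] V := fun w => 1 - (h w).comp ι
  let b := stdOrthonormalBasis ℂ V
  -- Fredholm determinant: 1 - K R(w) = (1 - ι h(w)) E(w), and injectivity of 1 - ι h(w) is read off
  -- from the determinant of 1 - h(w) ι on V.
  let d : ℂ → ℂ := fun w => Matrix.det (Matrix.of fun i j => inner ℂ (b i) (D w (b j)))
  have hdet (w : ℂ) : d w = LinearMap.det (D w : V →ₗ[ℂ] V) := by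
    rw [← LinearMap.det_toMatrix b.toBasis]
    refine congrArg Matrix.det (Matrix.ext fun i j => ?_)
    simp [LinearMap.toMatrix_apply, b.repr_apply_apply]
  have hEfac (w : ℂ) (hw : w ∈ U) (u : H) : u - K (R w u) = E w u - ι (h w (E w u)) := by
    have : Ring.inverse (E w) (E w u) = u := DFunLike.congr_fun (Ring.inverse_mul_cancel _ (hE w hw)) u
    have e : ι (h w (E w u)) = ι (g (R w u)) := by
      change ι (g (R w (Ring.inverse (E w) (E w u)))) = _
      rw [this]
    rw [e]
    simp [E]
    abel
  have hspec : ∀ w ∈ U, w ∈ spec (perturb S.generator K) → d w = 0 := by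
    intro w hw hσ
    obtain ⟨u, hu0, hu⟩ := exists_fixed_of_mem_spec hS hK (ha.trans hw) hσ
    have e := hEfac w hw u
    rw [← hR] at hu
    rw [hu, sub_self] at e
    have e' : E w u = ι (h w (E w u)) := (sub_eq_zero.1 e.symm)
    rw [hdet, LinearMap.det_eq_zero_iff_ker_ne_bot]
    refine (Submodule.ne_bot_iff _).2 ⟨h w (E w u), ?_, fun h0 => hu0 ?_⟩
    · rw [LinearMap.mem_ker]
      change h w (E w u) - h w (ι (h w (E w u))) = 0
      rw [← e', sub_self]
    · rw [h0, map_zero] at e'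
      have : Ring.inverse (E w) (E w u) = u :=
        DFunLike.congr_fun (Ring.inverse_mul_cancel _ (hE w hw)) u
      rw [← this, e', map_zero]
  have hnon : ∀ w ∈ U, d w = 0 → ¬ ‖K * R w‖ < 1 := by
    intro w hw hd hlt
    rw [hdet, LinearMap.det_eq_zero_iff_ker_ne_bot] at hd
    obtain ⟨v, hv, hv0⟩ := (Submodule.ne_bot_iff _).1 hd
    have hv' : v = h w (ι v) := by
      have : v - h w (ι v) = 0 := hv
      exact sub_eq_zero.1 this
    set u := Ring.inverse (E w) (ι v) with hu
    have hEu : E w u = ι v := DFunLike.congr_fun (Ring.mul_inverse_cancel _ (hE w hw)) (ι v)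
    have h1 := hEfac w hw u
    rw [hEu, ← hv', sub_self, sub_eq_zero] at h1
    have hu0 : u ≠ 0 := by
      intro h0
      rw [h0, map_zero] at hEu
      exact hv0 (Subtype.ext hEu.symm)
    have h2 : ‖u‖ ≤ ‖K * R w‖ * ‖u‖ := by
      conv_lhs => rw [h1]
      exact (K * R w).le_opNorm u
    have h3 : 0 < ‖u‖ := norm_pos_iff.2 hu0
    nlinarith
  have hUo : IsOpen U := isOpen_lt continuous_const Complex.continuous_re
  have han : AnalyticOnNhd ℂ d U := by
    intro w hw
    have hRa : AnalyticAt ℂ R w := analyticAt_resolvent (hUρ w hw)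
    have hEa : AnalyticAt ℂ E w := analyticAt_const.sub (analyticAt_const.mul hRa)
    have hIa : AnalyticAt ℂ (fun w => Ring.inverse (E w)) w :=
      AnalyticAt.fun_comp (g := Ring.inverse) (analyticOnNhd_inverse _ (hE w hw)) hEa
    have hRI : AnalyticAt ℂ (fun w => R w * Ring.inverse (E w)) w := hRa.mul hIa
    have hent (i j) : AnalyticAt ℂ (fun w => inner ℂ (b i) (D w (b j))) w := by
      have e : (fun w => inner ℂ (b i) (D w (b j))) = fun w => inner ℂ (b i) (b j) -
          ((innerSL ℂ (b i)).comp g) ((ContinuousLinearMap.apply ℂ H (ι (b j)))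
            (R w * Ring.inverse (E w))) := by
        ext w
        simp [D, h]
      rw [e]
      refine analyticAt_const.sub ?_
      exact (ContinuousLinearMap.analyticAt _ _).comp ((ContinuousLinearMap.analyticAt _ _).comp hRI)
    simp only [d, Matrix.det_apply]
    refine Finset.analyticAt_fun_sum _ fun σ _ => ?_
    simp only [Units.smul_def, zsmul_eq_mul]
    exact analyticAt_const.mul (Finset.analyticAt_fun_prod _ fun i _ => by simpa using hent _ _)
  have hconn : IsPreconnected U := (convex_halfSpace_re_gt a).isPreconnected
  have hzU : z ∈ U := haz
  -- Identity theorem: if d vanished near z it would vanish on all of U, but d ≠ 0 far out, where ‖K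
  -- R(w)‖ < 1. So the zeros of d are isolated.
  rcases (han z hzU).eventually_eq_zero_or_eventually_ne_zero with h0 | h0
  · exfalso
    have hz0 := han.eqOn_zero_of_preconnected_of_eventuallyEq_zero hconn hzU h0
    have h1 := eventually_norm_mul_resolvent_lt hS (a := a + 1) (by linarith) (isCompact_singleton (x := K))
      (by rintro _ rfl; exact hK) one_pos
    have hne : (atInftyRight (a + 1)).NeBot := by
      have ht : Tendsto (fun x : ℝ => (x : ℂ)) atTop (atInftyRight (a + 1)) := by
        refine tendsto_inf.2 ⟨?_, tendsto_principal.2 ?_⟩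
        · rw [← tendsto_norm_atTop_iff_cobounded]
          simpa using tendsto_abs_atTop_atTop
        · filter_upwards [eventually_ge_atTop (a + 1)] with x hx
          simpa using hx
      exact ht.neBot
    have hmem : ∀ᶠ w in atInftyRight (a + 1), a + 1 ≤ w.re := mem_inf_of_right (mem_principal_self _)
    obtain ⟨w, hw, hwa⟩ := (h1.and hmem).exists
    have hwU : w ∈ U := by simp only [hU, mem_ofPred_eq]; linarith
    exact hnon w hwU (hz0 hwU) (hw K rfl)
  · filter_upwards [h0, mem_nhdsWithin_of_mem_nhds (hUo.mem_nhds hzU)] with w hw hwU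
    by_contra hρ
    exact hw (hspec w hwU hρ)

/-- The part of the spectrum in a half-plane is uniformly bounded for compact sets of compact
perturbations. -/
theorem exists_bound_spec (hS : ∀ t : ℝ≥0, ‖S t‖ ≤ M * Real.exp (ω * t))
    (ha : ω < a) {𝒦 : Set (H →L[ℂ] H)} (h𝒦 : IsCompact 𝒦)
    (hcomp : ∀ K ∈ 𝒦, IsCompactOperator K) :
    ∃ ρ : ℝ, ∀ K ∈ 𝒦, specRight (perturb S.generator K) a ⊆ Metric.closedBall 0 ρ := by
  have h1 := eventually_norm_mul_resolvent_lt hS ha h𝒦 hcomp one_pos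
  rw [atInftyRight, eventually_inf_principal] at h1
  obtain ⟨ρ, -, hρ⟩ := (Filter.hasBasis_cobounded_norm (E := ℂ)).eventually_iff.1 h1
  refine ⟨ρ, fun K hK z hz => ?_⟩
  by_contra hzρ
  rw [mem_closedBall_zero_iff, not_le] at hzρ
  exact hz.1 (mem_resolventSet_perturb_of_isUnit hS (ha.trans_le hz.2)
    (isUnit_one_sub_of_norm_lt_one (hρ hzρ.le hz.2 K hK)))

/-- The set is closed, bounded by `exists_bound_spec` and discrete by
`eventually_mem_resolventSet_perturb`. -/
theorem finite_specRight (hS : ∀ t : ℝ≥0, ‖S t‖ ≤ M * Real.exp (ω * t))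
    (ha : ω < a) (hK : IsCompactOperator K) : (specRight (perturb S.generator K) a).Finite := by
  obtain ⟨ρ, hρ⟩ := exists_bound_spec hS ha (isCompact_singleton (x := K))
    (by rintro _ rfl; exact hK)
  have hcl : IsClosed (specRight (perturb S.generator K) a) :=
    (isClosed_spec _).inter (isClosed_le continuous_const Complex.continuous_re)
  have hc : IsCompact (specRight (perturb S.generator K) a) :=
    (isCompact_closedBall (0 : ℂ) ρ).of_isClosed_subset hcl (hρ K rfl)
  refine hc.finite (isDiscrete_iff_forall_mem_exists_isOpen.2 ?_)
  intro z hz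
  obtain ⟨W, hW, hWo, hzW⟩ := mem_nhds_iff.1
    (eventually_nhdsWithin_iff.1 (eventually_mem_resolventSet_perturb hS hK (ha.trans_le hz.2)))
  refine ⟨W, hWo, ?_⟩
  ext w
  constructor
  · rintro ⟨hw, hws⟩
    by_contra hne
    exact hws.1 (hW hw hne)
  · rintro rfl
    exact ⟨hzW, hz⟩

theorem exists_isIsolatingRadius (hS : ∀ t : ℝ≥0, ‖S t‖ ≤ M * Real.exp (ω * t))
    (hK : IsCompactOperator K) (hz : ω < z.re) (hσ : z ∈ spec (perturb S.generator K)) :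
    ∃ r, IsIsolatingRadius (perturb S.generator K) z r := by
  obtain ⟨r, hr, hball⟩ := Metric.nhds_basis_closedBall.mem_iff.1
    (eventually_nhdsWithin_iff.1 (eventually_mem_resolventSet_perturb hS hK hz))
  refine ⟨r, hr, ?_⟩
  ext w
  constructor
  · rintro ⟨hw, hws⟩
    by_contra hne
    exact hws (hball hw hne)
  · rintro rfl
    exact ⟨Metric.mem_closedBall_self hr.le, hσ⟩

end C0Semigroup

/-! ### Riesz integrals, spectral projections and the reduced resolvent. -/

open Set Metric

theorem ContinuousLinearMap.circleIntegral_comp_comm {E F : Type*} [NormedAddCommGroup E]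
    [NormedSpace ℂ E] [CompleteSpace E] [NormedAddCommGroup F] [NormedSpace ℂ F] [CompleteSpace F]
    (T : E →L[ℂ] F) {f : ℂ → E} {c : ℂ} {r : ℝ} (hf : CircleIntegrable f c r) :
    ∮ z in C(c, r), T (f z) = T (∮ z in C(c, r), f z) := by
  unfold circleIntegral
  rw [← T.intervalIntegral_comp_comm hf.out]
  simp

namespace UnboundedOperator

variable {H : Type*} [NormedAddCommGroup H] [NormedSpace ℂ H]
variable {A : H →ₗ.[ℂ] H} {c z w μ : ℂ} {r ω₀ : ℝ}

/-- `(2πi)⁻¹ ∮ R_A(ζ) dζ` over the circle of radius `r` about `c`. -/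
noncomputable def rieszIntegral (A : H →ₗ.[ℂ] H) (c : ℂ) (r : ℝ) : H →L[ℂ] H :=
  (2 * Real.pi * Complex.I : ℂ)⁻¹ • ∮ ζ in C(c, r), resolvent A ζ

/-- `(2πi)⁻¹ ∮ (ζ - z)⁻¹ R_A(ζ) dζ` over the circle of radius `r` about `c`. -/
noncomputable def cauchyResolvent (A : H →ₗ.[ℂ] H) (c : ℂ) (r : ℝ) (z : ℂ) : H →L[ℂ] H :=
  (2 * Real.pi * Complex.I : ℂ)⁻¹ • ∮ ζ in C(c, r), (ζ - z)⁻¹ • resolvent A ζ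

theorem resolvent_eq_of_eigenvector {x : H} {lam : ℂ} (hx : x ∈ A.domain)
    (h : A ⟨x, hx⟩ = lam • x) (hz : z ∈ resolventSet A) (hne : z ≠ lam) :
    resolvent A z x = (z - lam)⁻¹ • x := by
  have h1 : resolvent A z ((z - lam) • x) = x := resolvent_of_eq hz hx (by rw [h, sub_smul])
  rw [map_smul] at h1
  rw [eq_inv_smul_iff₀ (sub_ne_zero.2 hne), h1]

theorem mem_spec_of_eigenvector {x : H} {lam : ℂ} (hx : x ∈ A.domain) (hx0 : x ≠ 0)
    (h : A ⟨x, hx⟩ = lam • x) : lam ∈ spec A := by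
  intro hρ
  have h1 : resolvent A lam 0 = x := resolvent_of_eq hρ hx (by rw [h, sub_self])
  rw [map_zero] at h1
  exact hx0 h1.symm

theorem IsIsolatingRadius.sphere_subset (h : IsIsolatingRadius A μ r) :
    sphere μ r ⊆ resolventSet A := by
  intro ζ hζ
  by_contra hσ
  have : ζ ∈ ({μ} : Set ℂ) := h.2 ▸ ⟨sphere_subset_closedBall hζ, hσ⟩
  rw [mem_singleton_iff.1 this, mem_sphere, dist_self] at hζ
  exact h.1.ne hζ

theorem IsIsolatingRadius.eventually (h : IsIsolatingRadius A μ r) :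
    ∀ᶠ z in 𝓝[≠] μ, z ∈ resolventSet A := by
  rw [eventually_nhdsWithin_iff]
  filter_upwards [closedBall_mem_nhds μ h.1] with z hz hne
  by_contra hσ
  have : z ∈ ({μ} : Set ℂ) := h.2 ▸ ⟨hz, hσ⟩
  exact hne this

theorem exists_spectralProjection_eq (h : ∃ r, IsIsolatingRadius A μ r) :
    ∃ r, IsIsolatingRadius A μ r ∧ spectralProjection A μ = rieszIntegral A μ r := by
  refine ⟨h.choose, h.choose_spec, ?_⟩
  rw [spectralProjection, dif_pos h, rieszIntegral]

theorem totalProjection_eq_sum (hfin : (specRight A ω₀).Finite) :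
    totalProjection A ω₀ = ∑ μ ∈ hfin.toFinset, spectralProjection A μ :=
  finsum_mem_eq_finite_toFinset_sum _ hfin

theorem reducedResolvent_of_mem (hz : z ∈ resolventSet A) :
    reducedResolvent A ω₀ z = resolvent A z * (1 - totalProjection A ω₀) := by
  have : z ∉ specRight A ω₀ := fun h => h.1 hz
  rw [reducedResolvent, if_neg this]
  rfl

theorem sphere_subset_resolventSet (hball : closedBall c r ⊆ resolventSet A ∪ specRight A ω₀)
    (hσ : specRight A ω₀ ⊆ ball c r) : sphere c r ⊆ resolventSet A := fun _ hζ =>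
  (hball (sphere_subset_closedBall hζ)).resolve_right fun h =>
    (mem_ball.1 (hσ h)).ne (mem_sphere.1 hζ)

variable [CompleteSpace H]

theorem circleIntegral_sub_inv_eq_zero (hr : 0 ≤ r) (hz : z ∉ closedBall c r) :
    ∮ ζ in C(c, r), (ζ - z)⁻¹ = 0 := by
  refine DiffContOnCl.circleIntegral_eq_zero hr ?_
  refine DifferentiableOn.diffContOnCl fun ζ hζ => ?_
  have : ζ - z ≠ 0 := by
    rintro h
    exact hz (sub_eq_zero.1 h ▸ closure_ball_subset_closedBall hζ)
  exact (((differentiableAt_id.sub_const z).inv this)).differentiableWithinAt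

theorem circleIntegrable_resolvent (hr : 0 ≤ r) (hs : sphere c r ⊆ resolventSet A) :
    CircleIntegrable (resolvent A) c r :=
  ((continuousOn_resolvent A).mono hs).circleIntegrable hr

theorem continuousOn_sub_inv_smul_resolvent (hs : sphere c r ⊆ resolventSet A)
    (hz : z ∉ sphere c r) : ContinuousOn (fun ζ => (ζ - z)⁻¹ • resolvent A ζ) (sphere c r) := by
  refine ContinuousOn.smul (ContinuousOn.inv₀ (f := fun ζ => ζ - z) (by fun_prop) fun ζ hζ h => ?_)
    ((continuousOn_resolvent A).mono hs)
  exact hz (sub_eq_zero.1 h ▸ hζ)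

theorem mul_rieszIntegral (B : H →L[ℂ] H) (hr : 0 ≤ r) (hs : sphere c r ⊆ resolventSet A) :
    B * rieszIntegral A c r = (2 * Real.pi * Complex.I : ℂ)⁻¹ • ∮ ζ in C(c, r), B * resolvent A ζ := by
  have := ((ContinuousLinearMap.mul ℂ (H →L[ℂ] H)) B).circleIntegral_comp_comm
    (circleIntegrable_resolvent hr hs)
  rw [rieszIntegral, mul_smul_comm]
  congr 1
  exact this.symm

theorem rieszIntegral_mul (B : H →L[ℂ] H) (hr : 0 ≤ r) (hs : sphere c r ⊆ resolventSet A) :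
    rieszIntegral A c r * B = (2 * Real.pi * Complex.I : ℂ)⁻¹ • ∮ ζ in C(c, r), resolvent A ζ * B := by
  have := ((ContinuousLinearMap.mul ℂ (H →L[ℂ] H)).flip B).circleIntegral_comp_comm
    (circleIntegrable_resolvent hr hs)
  rw [rieszIntegral, smul_mul_assoc]
  congr 1
  exact this.symm

theorem commute_rieszIntegral {B : H →L[ℂ] H} (hr : 0 ≤ r) (hs : sphere c r ⊆ resolventSet A)
    (hB : ∀ ζ ∈ sphere c r, Commute B (resolvent A ζ)) : Commute B (rieszIntegral A c r) := by
  rw [commute_iff_eq, mul_rieszIntegral B hr hs, rieszIntegral_mul B hr hs]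
  congr 1
  exact circleIntegral.integral_congr hr fun ζ hζ => (hB ζ hζ).eq

/-- Integrate R(z) R(ζ) = (ζ - z)⁻¹ (R(z) - R(ζ)) over the circle. The scalar coefficient of R(z) is
1 for z inside and 0 for z outside, whence the next two results. -/
theorem resolvent_mul_rieszIntegral (hr : 0 ≤ r) (hs : sphere c r ⊆ resolventSet A)
    (hz : z ∈ resolventSet A) (hzs : z ∉ sphere c r) :
    resolvent A z * rieszIntegral A c r =
      ((2 * Real.pi * Complex.I : ℂ)⁻¹ • ∮ ζ in C(c, r), (ζ - z)⁻¹) • resolvent A z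
        - cauchyResolvent A c r z := by
  have e : (∮ ζ in C(c, r), (ζ - z)⁻¹) • resolvent A z = ∮ ζ in C(c, r), (ζ - z)⁻¹ • resolvent A z :=
    (circleIntegral.integral_smul_const (fun ζ => (ζ - z)⁻¹) (resolvent A z) c r).symm
  rw [mul_rieszIntegral _ hr hs, cauchyResolvent, smul_assoc, ← smul_sub, e,
    ← circleIntegral.integral_sub]
  · congr 1
    refine circleIntegral.integral_congr hr fun ζ hζ => ?_
    have hne : ζ - z ≠ 0 := fun h => hzs (sub_eq_zero.1 h ▸ hζ)
    rw [← smul_sub, resolvent_sub_resolvent hz (hs hζ), smul_smul, inv_mul_cancel₀ hne, one_smul,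
      (resolvent_commute hz (hs hζ)).eq]
  · refine ContinuousOn.circleIntegrable hr ?_
    refine ContinuousOn.smul (ContinuousOn.inv₀ (f := fun ζ => ζ - z) (by fun_prop)
      fun ζ hζ h => ?_) continuousOn_const
    exact hzs (sub_eq_zero.1 h ▸ hζ)
  · exact (continuousOn_sub_inv_smul_resolvent hs hzs).circleIntegrable hr

theorem resolvent_mul_one_sub_rieszIntegral (hr : 0 ≤ r) (hs : sphere c r ⊆ resolventSet A)
    (hz : z ∈ resolventSet A) (hzb : z ∈ ball c r) :
    resolvent A z * (1 - rieszIntegral A c r) = cauchyResolvent A c r z := by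
  rw [mul_sub, resolvent_mul_rieszIntegral hr hs hz (fun h => (mem_ball.1 hzb).ne (mem_sphere.1 h)),
    circleIntegral.integral_sub_inv_of_mem_ball hzb]
  have : (2 * Real.pi * Complex.I : ℂ) ≠ 0 := Complex.two_pi_I_ne_zero
  rw [smul_eq_mul, inv_mul_cancel₀ this]
  simp

theorem resolvent_mul_rieszIntegral_of_notMem (hr : 0 ≤ r) (hs : sphere c r ⊆ resolventSet A)
    (hz : z ∈ resolventSet A) (hzb : z ∉ closedBall c r) :
    resolvent A z * rieszIntegral A c r = -cauchyResolvent A c r z := by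
  rw [resolvent_mul_rieszIntegral hr hs hz (fun h => hzb (sphere_subset_closedBall h)),
    circleIntegral_sub_inv_eq_zero hr hzb]
  simp

/-- A Cauchy integral uses the resolvent on the circle only, so it is analytic inside whatever
spectrum the circle encloses. -/
theorem analyticOnNhd_cauchyResolvent (hr : 0 < r) (hs : sphere c r ⊆ resolventSet A) :
    AnalyticOnNhd ℂ (cauchyResolvent A c r) (ball c r) := by
  lift r to ℝ≥0 using hr.le
  have := (hasFPowerSeriesOn_cauchy_integral (circleIntegrable_resolvent r.2 hs)
    (by exact_mod_cast hr)).analyticOnNhd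
  rwa [Metric.eball_coe] at this

theorem eventually_norm_cauchyResolvent_le (hr : 0 ≤ r) (hs : sphere c r ⊆ resolventSet A)
    (hz : z ∉ sphere c r) : ∃ C, ∀ᶠ w in 𝓝 z, ‖cauchyResolvent A c r w‖ ≤ C := by
  obtain ⟨N, hN⟩ := (isCompact_sphere c r).exists_bound_of_continuousOn
    ((continuousOn_resolvent A).mono hs)
  set δ := |‖z - c‖ - r| / 2 with hδ
  have hpos : 0 < |‖z - c‖ - r| := abs_pos.2 fun h => hz (by
    rw [mem_sphere, dist_eq_norm]; linarith)
  have hδ0 : 0 < δ := by positivity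
  have hev : ∀ᶠ w in 𝓝 z, δ < |‖w - c‖ - r| := by
    have : Continuous fun w : ℂ => |‖w - c‖ - r| := by fun_prop
    exact (this.tendsto z).eventually (lt_mem_nhds (by rw [hδ]; linarith))
  refine ⟨r * (δ⁻¹ * N), ?_⟩
  filter_upwards [hev] with w hw
  refine circleIntegral.norm_two_pi_i_inv_smul_integral_le_of_norm_le_const hr fun ζ hζ => ?_
  rw [norm_smul, norm_inv]
  have h1 : δ ≤ ‖ζ - w‖ := by
    rw [mem_sphere, dist_eq_norm] at hζ
    rw [← hζ] at hw
    refine hw.le.trans ((abs_norm_sub_norm_le _ _).trans_eq ?_)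
    rw [sub_sub_sub_cancel_right, norm_sub_rev]
  gcongr
  exact hN ζ hζ

theorem IsIsolatingRadius.rieszIntegral_eq {r' : ℝ} (h : IsIsolatingRadius A μ r) (hr' : 0 < r')
    (hle : r' ≤ r) : rieszIntegral A μ r = rieszIntegral A μ r' := by
  have hsub : closedBall μ r \ {μ} ⊆ resolventSet A := by
    rintro z ⟨hz, hne⟩
    by_contra hσ
    have : z ∈ ({μ} : Set ℂ) := h.2 ▸ ⟨hz, hσ⟩
    exact hne this
  rw [rieszIntegral, rieszIntegral]
  congr 1
  refine Complex.circleIntegral_eq_of_differentiable_on_annulus_off_countable hr' hle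
    countable_empty ?_ ?_
  · refine (continuousOn_resolvent A).mono fun z hz => hsub ⟨hz.1, ?_⟩
    rintro rfl
    exact hz.2 (mem_ball_self hr')
  · intro z hz
    refine (analyticAt_resolvent (hsub ⟨ball_subset_closedBall hz.1.1, ?_⟩)).differentiableAt
    rintro rfl
    exact hz.1.2 (mem_closedBall_self hr'.le)

section Total

variable (hfin : (specRight A ω₀).Finite)
  (hiso : ∀ μ ∈ specRight A ω₀, ∃ r, IsIsolatingRadius A μ r)

-- Near μ, the factor 1 - P_μ replaces the resolvent by a Cauchy integral over a circle about μ, and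
-- every other P_ν by one over a circle that does not enclose μ; all of these stay bounded.
include hfin hiso in
theorem exists_bound_resolvent_mul_one_sub (hμ : μ ∈ specRight A ω₀) :
    ∃ C, ∀ᶠ z in 𝓝[≠] μ, ‖resolvent A z * (1 - totalProjection A ω₀)‖ ≤ C := by
  have hρ : ∀ᶠ z in 𝓝[≠] μ, z ∈ resolventSet A := (hiso μ hμ).choose_spec.eventually
  have h1 : ∃ C, ∀ᶠ z in 𝓝[≠] μ, ‖resolvent A z * (1 - spectralProjection A μ)‖ ≤ C := by
    obtain ⟨r, hr, e⟩ := exists_spectralProjection_eq (hiso μ hμ)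
    obtain ⟨C, hC⟩ := eventually_norm_cauchyResolvent_le (z := μ) hr.1.le hr.sphere_subset
      (by simpa using hr.1.ne)
    refine ⟨C, ?_⟩
    filter_upwards [hρ, mem_nhdsWithin_of_mem_nhds hC,
      mem_nhdsWithin_of_mem_nhds (ball_mem_nhds μ hr.1)] with z hz hzC hzb
    rwa [e, resolvent_mul_one_sub_rieszIntegral hr.1.le hr.sphere_subset hz hzb]
  have h2 : ∀ ν ∈ hfin.toFinset.erase μ,
      ∃ C, ∀ᶠ z in 𝓝[≠] μ, ‖resolvent A z * spectralProjection A ν‖ ≤ C := by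
    intro ν hν
    rw [Finset.mem_erase, hfin.mem_toFinset] at hν
    obtain ⟨r, hr, e⟩ := exists_spectralProjection_eq (hiso ν hν.2)
    have hμr : μ ∉ closedBall ν r := by
      intro h
      have : μ ∈ ({ν} : Set ℂ) := hr.2 ▸ ⟨h, hμ.1⟩
      exact hν.1 this.symm
    obtain ⟨C, hC⟩ := eventually_norm_cauchyResolvent_le (z := μ) hr.1.le hr.sphere_subset
      (fun h => hμr (sphere_subset_closedBall h))
    refine ⟨C, ?_⟩
    filter_upwards [hρ, mem_nhdsWithin_of_mem_nhds hC, mem_nhdsWithin_of_mem_nhds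
      (isClosed_closedBall.isOpen_compl.mem_nhds hμr)] with z hz hzC hzb
    rwa [e, resolvent_mul_rieszIntegral_of_notMem hr.1.le hr.sphere_subset hz hzb, norm_neg]
  obtain ⟨C, hC⟩ := h1
  choose! D hD using h2
  refine ⟨C + ∑ ν ∈ hfin.toFinset.erase μ, D ν, ?_⟩
  have hD' : ∀ᶠ z in 𝓝[≠] μ, ∀ ν ∈ hfin.toFinset.erase μ,
      ‖resolvent A z * spectralProjection A ν‖ ≤ D ν :=
    (Finset.eventually_all _).2 hD
  filter_upwards [hC, hD'] with z hz hzD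
  have e : resolvent A z * (1 - totalProjection A ω₀) = resolvent A z * (1 - spectralProjection A μ)
      - ∑ ν ∈ hfin.toFinset.erase μ, resolvent A z * spectralProjection A ν := by
    rw [totalProjection_eq_sum hfin, ← Finset.add_sum_erase _ _ (hfin.mem_toFinset.2 hμ),
      ← Finset.mul_sum]
    noncomm_ring
  rw [e]
  exact (norm_sub_le _ _).trans (add_le_add hz (norm_sum_le_of_le _ hzD))

-- Riemann's removable singularity theorem: boundedness near each spectral point makes the limit in
-- the definition exist and extend the function analytically.
include hfin hiso in
theorem analyticOnNhd_reducedResolvent :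
    AnalyticOnNhd ℂ (reducedResolvent A ω₀) (resolventSet A ∪ specRight A ω₀) := by
  rintro z (hz | hz)
  · have h1 : AnalyticAt ℂ (fun w => resolvent A w * (1 - totalProjection A ω₀)) z :=
      (analyticAt_resolvent hz).mul analyticAt_const
    refine h1.congr ?_
    filter_upwards [(isOpen_resolventSet A).mem_nhds hz] with w hw
    exact (reducedResolvent_of_mem hw).symm
  · set f : ℂ → H →L[ℂ] H := fun w => resolvent A w * (1 - totalProjection A ω₀)
    have hρ : ∀ᶠ w in 𝓝[≠] z, w ∈ resolventSet A := (hiso z hz).choose_spec.eventually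
    have hd : ∀ᶠ w in 𝓝[≠] z, DifferentiableAt ℂ f w := by
      filter_upwards [hρ] with w hw
      exact ((analyticAt_resolvent hw).mul analyticAt_const).differentiableAt
    obtain ⟨C, hC⟩ := exists_bound_resolvent_mul_one_sub hfin hiso hz
    have ht := Complex.tendsto_limUnder_of_differentiable_on_punctured_nhds_of_bounded_under hd
      ⟨C + ‖f z‖, by
        rw [eventually_map]
        filter_upwards [hC] with w hw
        exact (norm_sub_le _ _).trans (by gcongr)⟩
    have heq : ∀ᶠ w in 𝓝[≠] z, f w = reducedResolvent A ω₀ w := by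
      filter_upwards [hρ] with w hw
      exact (reducedResolvent_of_mem hw).symm
    have hz0 : reducedResolvent A ω₀ z = limUnder (𝓝[≠] z) f := by
      rw [reducedResolvent, if_pos hz]; rfl
    refine Complex.analyticAt_of_differentiable_on_punctured_nhds_of_continuousAt ?_ ?_
    · filter_upwards [hρ, hd] with w hw hdw
      refine hdw.congr_of_eventuallyEq ?_
      filter_upwards [(isOpen_resolventSet A).mem_nhds hw] with u hu
      exact reducedResolvent_of_mem hu
    · rw [continuousAt_iff_punctured_nhds, hz0]
      exact ht.congr' heq

include hfin hiso in
/-- The contour integral over a circle surrounding exactly the right part of the spectrum is the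
total projection, and is annihilated by its complement. -/
theorem totalProjection_eq_rieszIntegral (hr : 0 < r)
    (hball : closedBall c r ⊆ resolventSet A ∪ specRight A ω₀) (hσ : specRight A ω₀ ⊆ ball c r) :
    totalProjection A ω₀ = rieszIntegral A c r ∧
      (1 - totalProjection A ω₀) * rieszIntegral A c r = 0 := by
  have hs := sphere_subset_resolventSet hball hσ
  have hcomm (B : H →L[ℂ] H) (ζ) (hζ : ζ ∈ resolventSet A)
      (hB : Commute (resolvent A ζ) B) :
      (1 - B) * resolvent A ζ = resolvent A ζ * (1 - B) := by
    rw [sub_mul, mul_sub, hB.eq]; simp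
  have h1 : ∀ μ ∈ specRight A ω₀,
      spectralProjection A μ * rieszIntegral A c r = spectralProjection A μ := by
    intro μ hμ
    obtain ⟨r₁, hr₁, e⟩ := exists_spectralProjection_eq (hiso μ hμ)
    obtain ⟨r₂, hr₂, hsub⟩ := nhds_basis_closedBall.mem_iff.1 (isOpen_ball.mem_nhds (hσ hμ))
    -- The small circle has to lie inside the large disc, where the Cauchy integral over the large
    -- circle is analytic. Hence P_μ (1 - Π) = 0, with Π the Riesz integral over the large circle.
    set s := min r₁ r₂ with hsdef
    have hs0 : 0 < s := lt_min hr₁.1 hr₂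
    have hsub' : closedBall μ s ⊆ ball c r :=
      (closedBall_subset_closedBall (min_le_right _ _)).trans hsub
    rw [e, hr₁.rieszIntegral_eq hs0 (min_le_left _ _)]
    have hss : sphere μ s ⊆ resolventSet A := by
      intro ζ hζ
      by_contra hσ
      have : ζ ∈ ({μ} : Set ℂ) :=
        hr₁.2 ▸ ⟨closedBall_subset_closedBall (min_le_left _ _) (sphere_subset_closedBall hζ), hσ⟩
      rw [mem_singleton_iff.1 this, mem_sphere, dist_self] at hζ
      exact hs0.ne hζ
    have h0 : rieszIntegral A μ s * (1 - rieszIntegral A c r) = 0 := by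
      rw [rieszIntegral_mul _ hs0.le hss, circleIntegral.integral_congr hs0.le
        (g := cauchyResolvent A c r) fun ζ hζ => resolvent_mul_one_sub_rieszIntegral hr.le hs
          (hss hζ) (hsub' (sphere_subset_closedBall hζ))]
      rw [DiffContOnCl.circleIntegral_eq_zero hs0.le, smul_zero]
      exact ((analyticOnNhd_cauchyResolvent hr hs).differentiableOn.mono
        (closure_ball_subset_closedBall.trans hsub')).diffContOnCl
    rw [mul_sub, mul_one, sub_eq_zero] at h0
    exact h0.symm
  have h2 : totalProjection A ω₀ * rieszIntegral A c r = totalProjection A ω₀ := by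
    rw [totalProjection_eq_sum hfin, Finset.sum_mul]
    exact Finset.sum_congr rfl fun μ hμ => h1 μ (hfin.mem_toFinset.1 hμ)
  have hcommP : ∀ ζ ∈ resolventSet A, Commute (resolvent A ζ) (totalProjection A ω₀) := by
    intro ζ hζ
    rw [totalProjection_eq_sum hfin]
    refine Commute.sum_right _ _ _ fun μ hμ => ?_
    obtain ⟨r₁, hr₁, e⟩ := exists_spectralProjection_eq (hiso μ (hfin.mem_toFinset.1 hμ))
    rw [e]
    exact commute_rieszIntegral hr₁.1.le hr₁.sphere_subset fun ξ hξ =>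
      resolvent_commute hζ (hr₁.sphere_subset hξ)
  -- On the circle (1 - P) R(ζ) is the reduced resolvent, which is analytic on the whole closed
  -- disc, so its integral vanishes. Together with P Π = P this gives Π = P Π = P.
  have h3 : (1 - totalProjection A ω₀) * rieszIntegral A c r = 0 := by
    rw [mul_rieszIntegral _ hr.le hs, circleIntegral.integral_congr hr.le
      (g := reducedResolvent A ω₀) fun ζ hζ => by
        rw [reducedResolvent_of_mem (hs hζ), hcomm _ ζ (hs hζ) (hcommP ζ (hs hζ))]]
    rw [DiffContOnCl.circleIntegral_eq_zero hr.le, smul_zero]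
    exact ((analyticOnNhd_reducedResolvent hfin hiso).differentiableOn.mono
      (closure_ball_subset_closedBall.trans hball)).diffContOnCl
  refine ⟨?_, h3⟩
  rw [sub_mul, one_mul, sub_eq_zero] at h3
  rw [h3, h2]

-- On an eigenvector R(ζ) x = (ζ - λ)⁻¹ x, and λ lies outside every circle that defines P. Thus
-- eigenvectors from the strip left of Re z = ω₀ can be used to test both conditions.
include hfin hiso in
theorem totalProjection_eigenvector {x : H} {lam : ℂ} (hx : x ∈ A.domain)
    (h : A ⟨x, hx⟩ = lam • x) (hlam : lam ∉ specRight A ω₀) : totalProjection A ω₀ x = 0 := by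
  by_cases hx0 : x = 0
  · rw [hx0, map_zero]
  have hσ := mem_spec_of_eigenvector hx hx0 h
  rw [totalProjection_eq_sum hfin, _root_.sum_apply]
  refine Finset.sum_eq_zero fun μ hμ => ?_
  rw [hfin.mem_toFinset] at hμ
  obtain ⟨r, hr, e⟩ := exists_spectralProjection_eq (hiso μ hμ)
  have hlr : lam ∉ closedBall μ r := by
    intro hmem
    have : lam ∈ ({μ} : Set ℂ) := hr.2 ▸ ⟨hmem, hσ⟩
    exact hlam (mem_singleton_iff.1 this ▸ hμ)
  have h1 := (ContinuousLinearMap.apply ℂ H x).circleIntegral_comp_comm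
    (circleIntegrable_resolvent hr.1.le hr.sphere_subset)
  simp only [ContinuousLinearMap.apply_apply] at h1
  rw [e, rieszIntegral, _root_.smul_apply, ← h1, circleIntegral.integral_congr hr.1.le
    (g := fun ζ => (ζ - lam)⁻¹ • x) fun ζ hζ => resolvent_eq_of_eigenvector hx h
      (hr.sphere_subset hζ) (fun h => hlr (h ▸ sphere_subset_closedBall hζ)),
    circleIntegral.integral_smul_const, circleIntegral_sub_inv_eq_zero hr.1.le hlr]
  simp

include hfin hiso in
theorem norm_reducedResolvent_le_of_forall {Ω : Set ℂ} {C : ℝ} (hΩ : IsOpen Ω) (hz : z ∈ Ω)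
    (hz' : z ∈ resolventSet A ∪ specRight A ω₀)
    (h : ∀ w ∈ Ω, w ∈ resolventSet A → ‖resolvent A w * (1 - totalProjection A ω₀)‖ ≤ C) :
    ‖reducedResolvent A ω₀ z‖ ≤ C := by
  rcases hz' with hzρ | hzσ
  · rw [reducedResolvent_of_mem hzρ]
    exact h z hz hzρ
  · have hc := ((analyticOnNhd_reducedResolvent hfin hiso) z (Or.inr hzσ)).continuousAt.norm
    refine le_of_tendsto (hc.tendsto.mono_left (nhdsWithin_le_nhds (s := {z}ᶜ))) ?_
    filter_upwards [(hiso z hzσ).choose_spec.eventually,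
      mem_nhdsWithin_of_mem_nhds (hΩ.mem_nhds hz)] with w hw hwΩ
    rw [reducedResolvent_of_mem hw]
    exact h w hwΩ hw

end Total

end UnboundedOperator

/-! ### Plancherel's theorem and Laplace transforms on vertical lines. -/

section Plancherel

open MeasureTheory FourierTransform
open scoped SchwartzMap ENNReal

variable {H : Type*} [NormedAddCommGroup H] [InnerProductSpace ℂ H]

theorem continuous_fourier_of_integrable {f : ℝ → H} (hf : Integrable f) : Continuous (𝓕 f) :=
  VectorFourier.fourierIntegral_continuous Real.continuous_fourierChar
    (L := innerₗ ℝ) continuous_inner hf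

/-- On `L¹ ∩ L²` the Fourier integral agrees with the `L²` Fourier transform. -/
theorem fourier_ae_eq_fourier_toLp [CompleteSpace H] {f : ℝ → H} (hf : Integrable f) (hf2 : MemLp f 2) :
    ((𝓕 (hf2.toLp f) : Lp H 2 (volume : Measure ℝ)) : ℝ → H) =ᵐ[volume] 𝓕 f := by
  refine ae_eq_of_integral_contDiff_smul_eq
    ((Lp.memLp _).locallyIntegrable (by norm_num))
    (continuous_fourier_of_integrable hf).locallyIntegrable fun g hg hgc => ?_
  have hg' : HasCompactSupport (Complex.ofRealCLM ∘ g) := hgc.comp_left rfl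
  let φ : 𝓢(ℝ, ℂ) := hg'.toSchwartzMap (Complex.ofRealCLM.contDiff.comp hg)
  have hφ (x : ℝ) : φ x = (g x : ℂ) := rfl
  -- The L² transform moves onto the test function by duality of tempered distributions, the Fourier
  -- integral by Fubini (`h3`), so the two agree against every test function.
  have h1 := DFunLike.congr_fun (Lp.fourier_toTemperedDistribution_eq (hf2.toLp f)) φ
  rw [TemperedDistribution.fourier_apply, Lp.toTemperedDistribution_apply,
    Lp.toTemperedDistribution_apply] at h1
  have h2 : ∫ x, (𝓕 φ) x • (hf2.toLp f) x = ∫ x, (𝓕 (φ : ℝ → ℂ)) x • f x := by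
    refine integral_congr_ae ?_
    filter_upwards [hf2.coeFn_toLp] with x hx
    rw [hx]; rfl
  have h3 : ∫ x, (𝓕 (φ : ℝ → ℂ)) x • f x = ∫ x, φ x • (𝓕 f) x := by
    have := VectorFourier.integral_fourierIntegral_smul_eq_flip (μ := volume) (ν := volume)
      (L := innerₗ ℝ) Real.continuous_fourierChar continuous_inner φ.integrable hf
    rw [flip_innerₗ] at this
    exact this
  rw [h2, h3] at h1
  simp only [hφ, Complex.coe_smul] at h1
  exact h1.symm

theorem memLp_fourier [CompleteSpace H] {f : ℝ → H} (hf : Integrable f) (hf2 : MemLp f 2) : MemLp (𝓕 f) 2 :=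
  (memLp_congr_ae (fourier_ae_eq_fourier_toLp hf hf2)).1 (Lp.memLp _)

/-- Plancherel's theorem on `L¹ ∩ L²`. -/
theorem integral_norm_sq_fourier [CompleteSpace H] {f : ℝ → H} (hf : Integrable f) (hf2 : MemLp f 2) :
    ∫ ξ, ‖𝓕 f ξ‖ ^ 2 = ∫ t, ‖f t‖ ^ 2 := by
  have key (g : Lp H 2 (volume : Measure ℝ)) : ∫ x, ‖g x‖ ^ 2 = ‖g‖ ^ 2 := by
    have := L2.inner_def (𝕜 := ℂ) g g
    rw [inner_self_eq_norm_sq_to_K] at this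
    simp only [inner_self_eq_norm_sq_to_K] at this
    have h2 : ((‖g‖ ^ 2 : ℝ) : ℂ) = ((∫ x, ‖g x‖ ^ 2 : ℝ) : ℂ) := by
      rw [← integral_complex_ofReal]
      push_cast
      exact this
    exact_mod_cast h2.symm
  have h1 : ∫ ξ, ‖𝓕 f ξ‖ ^ 2 = ∫ ξ, ‖(𝓕 (hf2.toLp f) : Lp H 2 (volume : Measure ℝ)) ξ‖ ^ 2 := by
    refine integral_congr_ae ?_
    filter_upwards [fourier_ae_eq_fourier_toLp hf hf2] with x hx
    rw [hx]
  have h2 : ∫ t, ‖f t‖ ^ 2 = ∫ t, ‖hf2.toLp f t‖ ^ 2 := by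
    refine integral_congr_ae ?_
    filter_upwards [hf2.coeFn_toLp] with x hx
    rw [hx]
  rw [h1, h2, key, key, Lp.norm_fourier_eq]

end Plancherel

namespace C0Semigroup

open MeasureTheory FourierTransform Set

variable {H : Type*} [NormedAddCommGroup H] [InnerProductSpace ℂ H]
variable {S : C0Semigroup H} {x : H} {N b a : ℝ}

theorem memLp_rescale_orbit (hx : ∀ t : ℝ≥0, ‖S t x‖ ≤ N * Real.exp (b * t)) (hb : b < a) :
    MemLp ((S.rescale a).orbit x) 2 (volume.restrict (Ioi 0)) := by
  have hm := ((S.rescale a).continuous_orbit x).aestronglyMeasurable (μ := volume.restrict (Ioi 0))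
  rw [memLp_two_iff_integrable_sq_norm hm]
  have h1 := (integrableOn_exp_mul_Ioi (a := -(a - b) * 2) (by linarith) 0).const_mul (N ^ 2)
  refine h1.mono' (hm.norm.pow 2) ?_
  filter_upwards [self_mem_ae_restrict measurableSet_Ioi] with t (ht : 0 < t)
  have h2 := norm_rescale_orbit_le (z := a) hx ht.le
  rw [Complex.ofReal_re] at h2
  rw [Real.norm_of_nonneg (by positivity)]
  calc _ ≤ (N * Real.exp (-(a - b) * t)) ^ 2 := by gcongr
    _ = _ := by rw [mul_pow, ← Real.exp_nat_mul]; ring_nf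

/-- The factor 2π in the argument comes from the normalisation of `𝓕`. -/
theorem fourier_indicator_orbit (S : C0Semigroup H) (x : H) (a ξ : ℝ) :
    𝓕 ((Ioi 0).indicator ((S.rescale a).orbit x)) ξ =
      S.laplace (a + (2 * Real.pi * ξ : ℝ) * Complex.I) x := by
  rw [Real.fourier_real_eq_integral_exp_smul, laplace, ← integral_indicator measurableSet_Ioi]
  refine integral_congr_ae (ae_of_all _ fun t => ?_)
  simp only [indicator]
  split_ifs with ht
  · have ht' : (0 : ℝ) ≤ t := le_of_lt ht
    simp only [orbit, rescale_apply, smul_smul, Real.coe_toNNReal _ ht', ← Complex.exp_add]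
    congr 2
    push_cast
    ring
  · simp

theorem integrable_indicator_orbit (hx : ∀ t : ℝ≥0, ‖S t x‖ ≤ N * Real.exp (b * t)) (hb : b < a) :
    Integrable ((Ioi 0).indicator ((S.rescale a).orbit x)) :=
  (integrable_indicator_iff measurableSet_Ioi).2 (integrableOn_rescale_orbit hx (by simpa using hb))

theorem memLp_indicator_orbit (hx : ∀ t : ℝ≥0, ‖S t x‖ ≤ N * Real.exp (b * t)) (hb : b < a) :
    MemLp ((Ioi 0).indicator ((S.rescale a).orbit x)) 2 :=
  (memLp_indicator_iff_restrict measurableSet_Ioi).2 (memLp_rescale_orbit hx hb)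

theorem integrable_norm_sq_laplace [CompleteSpace H] (hx : ∀ t : ℝ≥0, ‖S t x‖ ≤ N * Real.exp (b * t)) (hb : b < a) :
    Integrable fun ξ : ℝ => ‖S.laplace (a + (2 * Real.pi * ξ : ℝ) * Complex.I) x‖ ^ 2 := by
  have hi := integrable_indicator_orbit hx hb
  have := (memLp_two_iff_integrable_sq_norm
    (continuous_fourier_of_integrable hi).aestronglyMeasurable).1
      (memLp_fourier hi (memLp_indicator_orbit hx hb))
  simpa only [fourier_indicator_orbit] using this

/-- Plancherel's theorem for the Laplace transform of an orbit. -/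
theorem integral_norm_sq_laplace [CompleteSpace H] (hx : ∀ t : ℝ≥0, ‖S t x‖ ≤ N * Real.exp (b * t)) (hb : b < a) :
    ∫ ξ : ℝ, ‖S.laplace (a + (2 * Real.pi * ξ : ℝ) * Complex.I) x‖ ^ 2 =
      ∫ t in Ioi (0 : ℝ), ‖(S.rescale a).orbit x t‖ ^ 2 := by
  have := integral_norm_sq_fourier (integrable_indicator_orbit hx hb) (memLp_indicator_orbit hx hb)
  simp only [fourier_indicator_orbit] at this
  rw [this, ← integral_indicator measurableSet_Ioi]
  refine integral_congr_ae (ae_of_all _ fun t => ?_)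
  simp only [indicator]
  split_ifs <;> simp

end C0Semigroup

/-! ### A quantitative Gearhart–Prüss theorem. -/

namespace C0Semigroup

open MeasureTheory Set UnboundedOperator

variable {H : Type*} [NormedAddCommGroup H]

section Normed

variable [NormedSpace ℂ H]

/-- Averaging ‖U(t) y‖² ≤ c² ‖U(s) y‖² over s in [t - τ, t] converts an L² bound into a pointwise
one. Window τ = 1 yields boundedness, the full window τ = t yields decay (Datko's argument). -/
theorem mul_norm_sq_le_integral {U : C0Semigroup H} {y : H} {c t τ : ℝ} (hτ : 0 ≤ τ) (hτt : τ ≤ t)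
    (h : ∀ s : ℝ, 0 ≤ s → t - τ ≤ s → s ≤ t → ‖U.orbit y t‖ ≤ c * ‖U.orbit y s‖)
    (hi : IntegrableOn (fun s => ‖U.orbit y s‖ ^ 2) (Ioi 0)) :
    τ * ‖U.orbit y t‖ ^ 2 ≤ c ^ 2 * ∫ s in Ioi (0 : ℝ), ‖U.orbit y s‖ ^ 2 := by
  have hc : Continuous fun s => ‖U.orbit y s‖ ^ 2 := (U.continuous_orbit y).norm.pow 2
  have h1 : ∫ _ in (t - τ)..t, ‖U.orbit y t‖ ^ 2 ≤ ∫ s in (t - τ)..t, c ^ 2 * ‖U.orbit y s‖ ^ 2 := by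
    refine intervalIntegral.integral_mono_on (by linarith) (by simp)
      ((hc.const_mul _).intervalIntegrable _ _) fun s hs => ?_
    rw [← mul_pow]
    exact pow_le_pow_left₀ (norm_nonneg _) (h s (by linarith [hs.1]) hs.1 hs.2) 2
  rw [intervalIntegral.integral_const, sub_sub_cancel, smul_eq_mul,
    intervalIntegral.integral_const_mul, intervalIntegral.integral_of_le (by linarith)] at h1
  refine h1.trans (mul_le_mul_of_nonneg_left ?_ (sq_nonneg c))
  refine setIntegral_mono_set hi (ae_of_all _ fun s => by positivity) ?_
  exact (show Ioc (t - τ) t ⊆ Ioi 0 from fun s hs => lt_of_le_of_lt (by linarith) hs.1).eventuallyLE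

/-- If a semigroup contracts by the factor `1/2` at some time on an invariant set, then it decays
exponentially there. -/
theorem norm_le_of_half {U : C0Semigroup H} {Y : Set H} {M t₀ : ℝ} (ht₀ : 0 < t₀)
    (hY : ∀ t : ℝ≥0, ∀ y ∈ Y, U t y ∈ Y) (hM : ∀ t : ℝ≥0, ∀ y ∈ Y, ‖U t y‖ ≤ M * ‖y‖)
    (hM0 : 0 ≤ M) (h : ∀ y ∈ Y, ‖U t₀.toNNReal y‖ ≤ 1 / 2 * ‖y‖) (t : ℝ≥0) {y : H} (hy : y ∈ Y) :
    ‖U t y‖ ≤ 2 * M * Real.exp (-(Real.log 2 / t₀) * t) * ‖y‖ := by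
  have hpow : ∀ n : ℕ, ∀ y ∈ Y, ‖U (n * t₀.toNNReal) y‖ ≤ (1 / 2) ^ n * ‖y‖ := by
    intro n
    induction n with
    | zero => intro y _; simp [U.zero_apply]
    | succ n ih =>
      intro y hy
      have e : ((n + 1 : ℕ) : ℝ≥0) * t₀.toNNReal = n * t₀.toNNReal + t₀.toNNReal := by
        push_cast; ring
      rw [e, U.add_apply, pow_succ, mul_assoc]
      exact (ih _ (hY _ y hy)).trans (by gcongr; exact h y hy)
  set n := ⌊(t : ℝ) / t₀⌋₊ with hn
  have hn1 : (n : ℝ) * t₀ ≤ t := by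
    rw [← le_div_iff₀ ht₀]
    exact Nat.floor_le (by positivity)
  have hn2 : (t : ℝ) / t₀ < n + 1 := Nat.lt_floor_add_one _
  have hle : (n : ℝ≥0) * t₀.toNNReal ≤ t := by
    rw [← NNReal.coe_le_coe]
    push_cast
    rw [Real.coe_toNNReal _ ht₀.le]
    exact hn1
  obtain ⟨s, hs⟩ := exists_add_of_le hle
  have h1 : ‖U t y‖ ≤ M * ((1 / 2) ^ n * ‖y‖) := by
    rw [hs, add_comm, U.add_apply]
    exact (hM _ _ (hY _ y hy)).trans (by gcongr; exact hpow n y hy)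
  -- Since n > t/t₀ - 1, rounding down costs one factor of 2.
  have h2 : ((1 : ℝ) / 2) ^ n ≤ 2 * Real.exp (-(Real.log 2 / t₀) * t) := by
    have e2 : (2 : ℝ) = Real.exp (Real.log 2) := (Real.exp_log two_pos).symm
    have e3 : ((1 : ℝ) / 2) ^ n = Real.exp (-(n * Real.log 2)) := by
      rw [Real.exp_neg, Real.exp_nat_mul, Real.exp_log two_pos, one_div, inv_pow]
    rw [e3]
    nth_rewrite 2 [e2]
    rw [← Real.exp_add, Real.exp_le_exp]
    have hl : 0 < Real.log 2 := Real.log_pos one_lt_two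
    have : Real.log 2 / t₀ * t = Real.log 2 * (t / t₀) := by ring
    nlinarith
  calc _ ≤ M * ((1 / 2) ^ n * ‖y‖) := h1
    _ ≤ M * (2 * Real.exp (-(Real.log 2 / t₀) * t) * ‖y‖) := by gcongr
    _ = _ := by ring

end Normed

variable [InnerProductSpace ℂ H]
variable {T : C0Semigroup H} {Q : H →L[ℂ] H} {M₀ w₀ C a₁ : ℝ}

/-- The integral of `e^{-2wt} ‖T(t) y‖²` for `w = w₀ + 1` to the right of the growth bound. -/
theorem integral_norm_sq_rescale_le (hT : ∀ t : ℝ≥0, ‖T t‖ ≤ M₀ * Real.exp (w₀ * t)) (y : H) :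
    ∫ t in Ioi (0 : ℝ), ‖(T.rescale (w₀ + 1 : ℝ)).orbit y t‖ ^ 2 ≤ M₀ ^ 2 * ‖y‖ ^ 2 := by
  have hy (t : ℝ≥0) : ‖T t y‖ ≤ M₀ * ‖y‖ * Real.exp (w₀ * t) :=
    (ContinuousLinearMap.le_of_opNorm_le _ (hT t) y).trans_eq (by ring)
  have h1 := (integrableOn_exp_mul_Ioi (a := -2) (by norm_num) 0).const_mul ((M₀ * ‖y‖) ^ 2)
  have h2 := integral_mono_of_nonneg (μ := volume.restrict (Ioi (0 : ℝ)))
    (f := fun t => ‖(T.rescale (w₀ + 1 : ℝ)).orbit y t‖ ^ 2)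
    (ae_of_all _ fun t => by positivity) h1 (by
      filter_upwards [self_mem_ae_restrict measurableSet_Ioi] with t (ht : 0 < t)
      have h3 := norm_rescale_orbit_le (z := ((w₀ + 1 : ℝ) : ℂ)) hy ht.le
      rw [Complex.ofReal_re, add_sub_cancel_left] at h3
      calc _ ≤ (M₀ * ‖y‖ * Real.exp (-1 * t)) ^ 2 := by gcongr
        _ = _ := by rw [mul_pow, ← Real.exp_nat_mul]; ring_nf)
  refine h2.trans ?_
  rw [integral_const_mul, integral_exp_mul_Ioi (by norm_num)]
  simp only [mul_zero, Real.exp_zero]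
  nlinarith [mul_nonneg (sq_nonneg M₀) (sq_nonneg ‖y‖)]

variable [CompleteSpace H]

/-- Shifting the line of integration: bounds for the Laplace transform on a line to the right of the
growth bound transfer to the lines where the resolvent is bounded. -/
theorem integral_norm_sq_rescale_le_of_resolvent_bound
    (hT : ∀ t : ℝ≥0, ‖T t‖ ≤ M₀ * Real.exp (w₀ * t))
    (hQR : ∀ z ∈ UnboundedOperator.resolventSet T.generator,
      Commute Q (UnboundedOperator.resolvent T.generator z))
    (hfin : (specRight T.generator a₁).Finite)
    (hC : ∀ z : ℂ, a₁ ≤ z.re → z ∈ UnboundedOperator.resolventSet T.generator →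
      ‖UnboundedOperator.resolvent T.generator z * Q‖ ≤ C)
    {y : H} (hy : Q y = y) {N b a : ℝ} (hyb : ∀ t : ℝ≥0, ‖T t y‖ ≤ N * Real.exp (b * t))
    (hba : b < a) (ha : a₁ ≤ a) (haw : a ≤ w₀ + 1) :
    ∫ t in Ioi (0 : ℝ), ‖(T.rescale a).orbit y t‖ ^ 2 ≤
      (1 + (w₀ + 1 - a₁) * C) ^ 2 * (M₀ ^ 2 * ‖y‖ ^ 2) := by
  set w := w₀ + 1 with hw
  have hyw (t : ℝ≥0) : ‖T t y‖ ≤ M₀ * ‖y‖ * Real.exp (w₀ * t) :=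
    (ContinuousLinearMap.le_of_opNorm_le _ (hT t) y).trans_eq (by ring)
  have hw0 : w₀ < w := by linarith
  refine le_trans ?_ (mul_le_mul_of_nonneg_left (integral_norm_sq_rescale_le hT y) (sq_nonneg _))
  rw [← integral_norm_sq_laplace hyb hba, ← hw, ← integral_norm_sq_laplace hyw hw0,
    ← integral_const_mul]
  refine integral_mono_ae (integrable_norm_sq_laplace hyb hba)
    ((integrable_norm_sq_laplace hyw hw0).const_mul _) ?_
  -- The finitely many spectral points on the line Re z = a, where no resolvent bound is available,
  -- form a null set.
  have hnull : ∀ᵐ ξ : ℝ, (a + (2 * Real.pi * ξ : ℝ) * Complex.I : ℂ) ∉ specRight T.generator a₁ := by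
    have hinj : Function.Injective fun ξ : ℝ => (a + (2 * Real.pi * ξ : ℝ) * Complex.I : ℂ) := by
      intro ξ η h
      have := congrArg Complex.im h
      simpa [Real.pi_ne_zero] using this
    have := (hfin.preimage hinj.injOn).measure_zero volume
    exact measure_eq_zero_iff_ae_notMem.1 this
  filter_upwards [hnull] with ξ hξ
  set η : ℝ := 2 * Real.pi * ξ
  set z : ℂ := a + η * Complex.I with hz
  set z' : ℂ := w + η * Complex.I with hz'
  have hzre : z.re = a := by simp [hz]
  have hzre' : z'.re = w := by simp [hz']
  have hzρ : z ∈ UnboundedOperator.resolventSet T.generator := by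
    by_contra h
    exact hξ ⟨h, by simp only [mem_ofPred_eq, hzre]; exact ha⟩
  have hzρ' : z' ∈ UnboundedOperator.resolventSet T.generator :=
    mem_resolventSet_generator hT (by rw [hzre']; exact hw0)
  rw [← resolvent_eq_laplace hyb (by rw [hzre]; exact hba) hzρ,
    ← resolvent_eq_laplace hyw (by rw [hzre']; exact hw0) hzρ', ← mul_pow]
  set R := UnboundedOperator.resolvent T.generator
  have hQ' : Q (R z' y) = R z' y := by
    have := DFunLike.congr_fun (hQR z' hzρ').eq y
    simp only [mul_apply_eq_comp, hy] at this
    exact this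
  -- Here z' - z = w - a, and Q fixes R(z') y, so R(z) y = (1 + (w - a) R(z) Q) R(z') y; the bound C
  -- then compares the two lines pointwise.
  have e : R z y = R z' y + ((w - a : ℝ) : ℂ) • (R z * Q) (R z' y) := by
    have h1 := DFunLike.congr_fun (resolvent_sub_resolvent hzρ hzρ') y
    rw [(resolvent_commute hzρ' hzρ).eq] at h1
    simp only [_root_.sub_apply, _root_.smul_apply, mul_apply_eq_comp] at h1
    rw [sub_eq_iff_eq_add'] at h1
    rw [mul_apply_eq_comp, hQ', h1]
    congr 2
    simp [hz, hz']
  gcongr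
  rw [e]
  refine (norm_add_le _ _).trans ?_
  rw [norm_smul, Complex.norm_real, Real.norm_of_nonneg (by linarith)]
  have h2 := ContinuousLinearMap.le_of_opNorm_le _ (hC z (by rw [hzre]; exact ha) hzρ) (R z' y)
  calc _ ≤ ‖R z' y‖ + (w - a₁) * (C * ‖R z' y‖) := by
        gcongr
        linarith
    _ = _ := by ring

set_option maxHeartbeats 400000 in
/-- A quantitative form of the **Gearhart–Prüss theorem**: on the range of a projection commuting
with a semigroup, a bound for the resolvent in a closed half-plane gives a growth bound whose
constant depends only on the data. -/
theorem exists_growth_bound_of_resolvent_bound (hM₀ : 1 ≤ M₀) (ha₁ : a₁ ≤ w₀) :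
    ∃ M : ℝ, 1 ≤ M ∧ ∀ (T : C0Semigroup H) (Q : H →L[ℂ] H),
      (∀ t : ℝ≥0, ‖T t‖ ≤ M₀ * Real.exp (w₀ * t)) → Q * Q = Q → (∀ t : ℝ≥0, Commute Q (T t)) →
      (∀ z ∈ UnboundedOperator.resolventSet T.generator,
        Commute Q (UnboundedOperator.resolvent T.generator z)) →
      (specRight T.generator a₁).Finite →
      (∀ z : ℂ, a₁ ≤ z.re → z ∈ UnboundedOperator.resolventSet T.generator →
        ‖UnboundedOperator.resolvent T.generator z * Q‖ ≤ C) →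
      ∀ t : ℝ≥0, ‖T t * Q‖ ≤ M * Real.exp (a₁ * t) * ‖Q‖ := by
  -- For a₁ ≤ a ≤ w₀ + 1 and y in the range of Q: κ ‖y‖² will bound the integral of e^{-2at} ‖T(t)
  -- y‖², c ‖y‖ will bound e^{-at} ‖T(t) y‖ on [0, 1], and M ‖y‖ will bound it for all t. None
  -- depends on T or Q.
  obtain ⟨κ, hκ⟩ : ∃ r, r = (1 + (w₀ + 1 - a₁) * C) ^ 2 * M₀ ^ 2 := ⟨_, rfl⟩
  have hκ0 : 0 ≤ κ := by rw [hκ]; positivity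
  obtain ⟨c, hc⟩ : ∃ r, r = M₀ * Real.exp (w₀ - a₁) := ⟨_, rfl⟩
  have hw₁ : 0 ≤ w₀ - a₁ := by linarith
  have hc1 : 1 ≤ c := by
    rw [hc]
    nlinarith [Real.one_le_exp hw₁]
  obtain ⟨M, hM⟩ : ∃ r, r = c * (1 + κ) := ⟨_, rfl⟩
  have hcM : c ≤ M := by rw [hM]; exact le_mul_of_one_le_right (by linarith) (by linarith)
  have hM1 : 1 ≤ M := hc1.trans hcM
  refine ⟨M, hM1, fun T Q hT hQQ hQT hQR hfin hC => ?_⟩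
  set Y : Set H := {y | Q y = y} with hYdef
  have hY (t : ℝ≥0) (y) (hy : y ∈ Y) : T t y ∈ Y := by
    have := DFunLike.congr_fun (hQT t).eq y
    simp only [mul_apply_eq_comp] at this
    rw [hYdef, mem_ofPred_eq, this]
    congr 1
  -- Growth at rate b on the range of Q, with an uncontrolled constant N. It only makes the
  -- integrals converge; N does not enter the bounds derived from it.
  let G : ℝ → Prop := fun b => ∃ N, 0 ≤ N ∧ ∀ t : ℝ≥0, ∀ y ∈ Y, ‖T t y‖ ≤ N * ‖y‖ * Real.exp (b * t)
  have hG0 : G w₀ := ⟨M₀, by linarith, fun t y _ =>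
    (ContinuousLinearMap.le_of_opNorm_le _ (hT t) y).trans_eq (by ring)⟩
  have hL2 {b a : ℝ} (hb : G b) (hba : b < a) (ha : a₁ ≤ a) (haw : a ≤ w₀ + 1) {y : H} (hy : y ∈ Y) :
      IntegrableOn (fun s => ‖(T.rescale a).orbit y s‖ ^ 2) (Ioi 0) ∧
      ∫ t in Ioi (0 : ℝ), ‖(T.rescale a).orbit y t‖ ^ 2 ≤ κ * ‖y‖ ^ 2 := by
    obtain ⟨N, -, hN⟩ := hb
    have hyb (t : ℝ≥0) := hN t y hy
    refine ⟨(memLp_two_iff_integrable_sq_norm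
      ((T.rescale a).continuous_orbit y).aestronglyMeasurable).1 (memLp_rescale_orbit hyb hba), ?_⟩
    exact (integral_norm_sq_rescale_le_of_resolvent_bound hT hQR hfin hC hy hyb hba ha haw).trans_eq
      (by rw [hκ]; ring)
  have hloc {a : ℝ} (ha : a₁ ≤ a) (y : H) (s : ℝ≥0) (hts : s ≤ 1) :
      ‖T.rescale a s y‖ ≤ c * ‖y‖ := by
    rw [norm_rescale, Complex.ofReal_re]
    have h1 := ContinuousLinearMap.le_of_opNorm_le _ (hT s) y
    have h2 : Real.exp (-a * s) * Real.exp (w₀ * s) ≤ Real.exp (w₀ - a₁) := by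
      rw [← Real.exp_add, Real.exp_le_exp]
      have hs1 : (s : ℝ) ≤ 1 := by exact_mod_cast hts
      nlinarith [mul_nonneg (sub_nonneg.2 ha) s.coe_nonneg, mul_nonneg hw₁ (sub_nonneg.2 hs1)]
    calc _ ≤ Real.exp (-a * s) * (M₀ * Real.exp (w₀ * s) * ‖y‖) := by gcongr
      _ = M₀ * (Real.exp (-a * s) * Real.exp (w₀ * s)) * ‖y‖ := by ring
      _ ≤ c * ‖y‖ := by rw [hc]; gcongr
  have hunif {b a : ℝ} (hb : G b) (hba : b < a) (ha : a₁ ≤ a) (haw : a ≤ w₀ + 1) (t : ℝ≥0) {y : H}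
      (hy : y ∈ Y) : ‖T.rescale a t y‖ ≤ M * ‖y‖ := by
    obtain ⟨hi, hle⟩ := hL2 hb hba ha haw hy
    rcases le_total t 1 with ht | ht
    · exact (hloc ha y t ht).trans (by gcongr)
    · have h1 := mul_norm_sq_le_integral (U := T.rescale a) (y := y) (c := c) (t := t) (τ := 1)
        zero_le_one (by exact_mod_cast ht) (fun s hs hs1 hst => by
          have e : (T.rescale a).orbit y t =
              T.rescale a (t - s : ℝ).toNNReal ((T.rescale a).orbit y s) := by
            rw [← orbit_add _ _ (sub_nonneg.2 hst) hs, sub_add_cancel]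
          rw [e]
          refine hloc ha _ _ ?_
          rw [Real.toNNReal_le_iff_le_coe, NNReal.coe_one]
          linarith) hi
      rw [one_mul, orbit_coe] at h1
      refine abs_le_of_sq_le_sq' ?_ (by positivity) |>.2
      calc _ ≤ _ := h1
        _ ≤ c ^ 2 * (κ * ‖y‖ ^ 2) := by gcongr
        _ ≤ c ^ 2 * ((1 + κ) ^ 2 * ‖y‖ ^ 2) := by
          have : κ ≤ (1 + κ) ^ 2 := by nlinarith
          gcongr
        _ = _ := by rw [hM]; ring
  -- Large enough that M² κ ≤ t₀/4, so that e^{-a t₀} T(t₀) contracts by 1/2 on the range of Q; ε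
  -- below is the rate gained.
  obtain ⟨t₀, ht₀⟩ : ∃ r, r = 4 * (M ^ 2 * κ) + 1 := ⟨_, rfl⟩
  have ht₀1 : 1 ≤ t₀ := by rw [ht₀]; nlinarith [mul_nonneg (sq_nonneg M) hκ0]
  obtain ⟨ε, hε⟩ : ∃ r, r = Real.log 2 / t₀ := ⟨_, rfl⟩
  have hlog := Real.log_two_lt_d9
  have hε0 : 0 < ε := by rw [hε]; exact div_pos (Real.log_pos one_lt_two) (by linarith)
  have hε1 : ε ≤ 1 := by
    rw [hε, div_le_one (by linarith)]
    linarith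
  have hstep {b a : ℝ} (hb : G b) (hba : b < a) (ha : a₁ ≤ a) (haw : a ≤ w₀ + 1) : G (a - ε) := by
    have hhalf : ∀ y ∈ Y, ‖T.rescale a t₀.toNNReal y‖ ≤ 1 / 2 * ‖y‖ := by
      intro y hy
      obtain ⟨hi, hle⟩ := hL2 hb hba ha haw hy
      have h1 := mul_norm_sq_le_integral (U := T.rescale a) (y := y) (c := M) (t := t₀) (τ := t₀)
        (by linarith) le_rfl (fun s hs _ hst => by
          have e : (T.rescale a).orbit y t₀ =
              T.rescale a (t₀ - s : ℝ).toNNReal ((T.rescale a).orbit y s) := by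
            rw [← orbit_add _ _ (sub_nonneg.2 hst) hs, sub_add_cancel]
          rw [e]
          refine hunif hb hba ha haw _ ?_
          have h2 : Q (T s.toNNReal y) = T s.toNNReal y := hY s.toNNReal y hy
          change Q ((T.rescale a).orbit y s) = _
          rw [orbit, rescale_apply, map_smul, h2]) hi
      have h2 : t₀ * ‖(T.rescale a).orbit y t₀‖ ^ 2 ≤ t₀ * (1 / 2 * ‖y‖) ^ 2 := by
        calc _ ≤ _ := h1
          _ ≤ M ^ 2 * (κ * ‖y‖ ^ 2) := by gcongr
          _ ≤ _ := by
            have e : t₀ * (1 / 2 * ‖y‖) ^ 2 = M ^ 2 * (κ * ‖y‖ ^ 2) + ‖y‖ ^ 2 / 4 := by rw [ht₀]; ring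
            rw [e]
            linarith [sq_nonneg ‖y‖]
      have h3 := le_of_mul_le_mul_left h2 (by linarith)
      exact abs_le_of_sq_le_sq' h3 (by positivity) |>.2
    have hYa (t : ℝ≥0) (y) (hy : y ∈ Y) : T.rescale a t y ∈ Y := by
      change Q _ = _
      rw [rescale_apply, map_smul, show Q (T t y) = T t y from hY t y hy]
    refine ⟨2 * M, by linarith, fun t y hy => ?_⟩
    have h1 := norm_le_of_half (U := T.rescale a) (by linarith : 0 < t₀) hYa
      (fun t y hy => hunif hb hba ha haw t hy) (by linarith) hhalf t hy
    rw [norm_rescale, Complex.ofReal_re, ← hε] at h1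
    calc ‖T t y‖ = Real.exp (a * t) * (Real.exp (-a * t) * ‖T t y‖) := by
          rw [← mul_assoc, ← Real.exp_add]; simp
      _ ≤ Real.exp (a * t) * (2 * M * Real.exp (-ε * t) * ‖y‖) := by gcongr
      _ = 2 * M * ‖y‖ * (Real.exp (a * t) * Real.exp (-ε * t)) := by ring
      _ = _ := by rw [← Real.exp_add]; ring_nf
  -- Taking a = b + ε/2 in `hstep` improves the rate b by ε/2, with ε fixed, so finitely many steps
  -- lead below a₁. Then `hunif` at a = a₁ gives the constant M.
  have hiter : ∀ n : ℕ, (∃ b < a₁, G b) ∨ G (w₀ - n * (ε / 2)) := by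
    intro n
    induction n with
    | zero => right; simpa using hG0
    | succ n ih =>
      rcases ih with h | h
      · exact Or.inl h
      · by_cases hlt : w₀ - n * (ε / 2) < a₁
        · exact Or.inl ⟨_, hlt, h⟩
        · right
          have hnn : 0 ≤ n * (ε / 2) := by positivity
          have := hstep h (a := w₀ - n * (ε / 2) + ε / 2) (by linarith) (by linarith) (by linarith)
          convert this using 1
          push_cast; ring
  have hfinal : ∃ b < a₁, G b := by
    obtain ⟨n, hn⟩ := exists_nat_gt ((w₀ - a₁) / (ε / 2))
    rw [div_lt_iff₀ (by positivity)] at hn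
    rcases hiter n with h | h
    · exact h
    · exact ⟨_, by linarith, h⟩
  obtain ⟨b, hb, hGb⟩ := hfinal
  intro t
  refine ContinuousLinearMap.opNorm_le_bound _ (by positivity) fun x => ?_
  have hQx : Q x ∈ Y := DFunLike.congr_fun hQQ x
  have h1 := hunif hGb hb le_rfl (by linarith) t hQx
  rw [norm_rescale, Complex.ofReal_re] at h1
  calc ‖(T t * Q) x‖ = Real.exp (a₁ * t) * (Real.exp (-a₁ * t) * ‖T t (Q x)‖) := by
        rw [← mul_assoc, ← Real.exp_add]; simp
    _ ≤ Real.exp (a₁ * t) * (M * (‖Q‖ * ‖x‖)) := by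
        refine mul_le_mul_of_nonneg_left (h1.trans ?_) (Real.exp_pos _).le
        exact mul_le_mul_of_nonneg_left (Q.le_opNorm x) (by linarith)
    _ = _ := by ring

end C0Semigroup

/-! ### Uniformity over a compact family of perturbations. -/

open Set Metric

/-- The discs tangent to Re z = a from the right fill Re z > a as their centre c grows; expanding |z
- c|² shows that 2c(b - a) > ρ² suffices. This yields a contour around a set known only to be
bounded and in Re z ≥ b. -/
theorem Complex.exists_ball_right {a b : ℝ} (hab : a < b) (ρ : ℝ) :
    ∃ c : ℝ, a < c ∧ ∀ z : ℂ, b ≤ z.re → ‖z‖ ≤ ρ → z ∈ ball (c : ℂ) (c - a) := by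
  have hd : 0 < b - a := sub_pos.2 hab
  set c := ρ ^ 2 / (2 * (b - a)) + 1 + |a| with hc
  have hq : 0 ≤ ρ ^ 2 / (2 * (b - a)) := by positivity
  have hac : a < c := by rw [hc]; linarith [le_abs_self a]
  have hc0 : 0 < c := by rw [hc]; linarith [abs_nonneg a]
  have hρc : ρ ^ 2 < 2 * c * (b - a) := by
    have h1 : ρ ^ 2 / (2 * (b - a)) < c := by rw [hc]; linarith [abs_nonneg a]
    rw [div_lt_iff₀ (by positivity)] at h1
    linarith
  refine ⟨c, hac, fun z hz hzρ => ?_⟩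
  rw [mem_ball, dist_eq_norm]
  refine lt_of_pow_lt_pow_left₀ 2 (by linarith) ?_
  have h2 : ‖z‖ ^ 2 ≤ ρ ^ 2 := pow_le_pow_left₀ (norm_nonneg _) hzρ 2
  rw [← Complex.normSq_eq_norm_sq, Complex.normSq_apply] at h2 ⊢
  simp only [Complex.sub_re, Complex.ofReal_re, Complex.sub_im, Complex.ofReal_im, sub_zero]
  have h3 := mul_le_mul_of_nonneg_left hz hc0.le
  linarith [sq_nonneg a, show (z.re - c) * (z.re - c) + z.im * z.im =
      z.re * z.re + z.im * z.im - 2 * (c * z.re) + c * c by ring,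
    show (c - a) ^ 2 = c * c - 2 * c * a + a ^ 2 by ring,
    show 2 * c * (b - a) = 2 * (c * b) - 2 * c * a by ring]

theorem Complex.le_re_of_mem_closedBall {a c : ℝ} {z : ℂ} (hz : z ∈ closedBall (c : ℂ) (c - a)) :
    a ≤ z.re := by
  rw [mem_closedBall, dist_eq_norm] at hz
  have := (Complex.abs_re_le_norm (z - c)).trans hz
  rw [Complex.sub_re, Complex.ofReal_re] at this
  linarith [(abs_le.1 this).1]

namespace C0Semigroup

open UnboundedOperator hiding resolvent resolventSet

section Banach

variable {H : Type*} [NormedAddCommGroup H] [NormedSpace ℂ H]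

theorem exists_norm_le_of_growthBound_lt {S : C0Semigroup H} {a : ℝ} (h : S.growthBound < a) :
    ∃ ω < a, ∃ M : ℝ, 1 ≤ M ∧ ∀ τ : ℝ≥0, ‖S τ‖ ≤ M * Real.exp (ω * τ) := by
  obtain ⟨_, ⟨ω, ⟨M, hM, hS⟩, rfl⟩, hω⟩ := sInf_lt_iff.1 h
  exact ⟨ω, EReal.coe_lt_coe_iff.1 hω, M, hM, hS⟩

theorem commute_resolvent (S : C0Semigroup H) (t : ℝ≥0) {z : ℂ}
    (hz : z ∈ UnboundedOperator.resolventSet S.generator) :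
    Commute (S t) (UnboundedOperator.resolvent S.generator z) := by
  ext x
  obtain ⟨hd, e⟩ := (isResolventAt_resolvent hz).1 x
  have h1 := (S.hasGeneratorAt_generator ⟨_, hd⟩).apply t
  refine (resolvent_of_eq hz ⟨_, h1⟩ ?_).symm
  rw [h1.generator_apply, ← map_smul, ← map_sub]
  exact congrArg (S t) e

theorem HasGeneratorAt.apply_eq_exp_smul {S : C0Semigroup H} {x : H} {lam : ℂ}
    (h : S.HasGeneratorAt x (lam • x)) (t : ℝ≥0) :
    S t x = Complex.exp (lam * (t : ℝ)) • x := by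
  have h0 := h.rescale lam
  rw [sub_self] at h0
  have h1 := constant_of_has_deriv_right_zero (a := 0) (b := t)
    ((S.rescale lam).continuous_orbit x).continuousOn (fun s hs => by
      have := h0.hasDerivWithinAt hs.1
      simpa [orbit] using this) t ⟨t.2, le_rfl⟩
  rw [orbit_coe, orbit_zero, rescale_apply] at h1
  conv_rhs => rw [← h1]
  rw [smul_smul, ← Complex.exp_add]
  simp

variable [CompleteSpace H]

/-- R(z)(1 - K R(z))⁻¹ is jointly continuous in (K, z), and 𝒦 × Z is compact. -/
theorem exists_bound_resolvent_perturb {S : C0Semigroup H} {M ω : ℝ}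
    (hS : ∀ t : ℝ≥0, ‖S t‖ ≤ M * Real.exp (ω * t)) {𝒦 : Set (H →L[ℂ] H)} (h𝒦 : IsCompact 𝒦)
    {Z : Set ℂ} (hZ : IsCompact Z) (hZω : ∀ z ∈ Z, ω < z.re)
    (hZρ : ∀ K ∈ 𝒦, Z ⊆ UnboundedOperator.resolventSet (perturb S.generator K)) :
    ∃ N, ∀ K ∈ 𝒦, ∀ z ∈ Z, ‖UnboundedOperator.resolvent (perturb S.generator K) z‖ ≤ N := by
  set R := UnboundedOperator.resolvent S.generator
  have hρ : ∀ z ∈ Z, z ∈ UnboundedOperator.resolventSet S.generator := fun z hz =>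
    mem_resolventSet_generator hS (hZω z hz)
  have hcont : ContinuousOn (fun p : (H →L[ℂ] H) × ℂ => R p.2 * Ring.inverse (1 - p.1 * R p.2))
      (𝒦 ×ˢ Z) := by
    rintro ⟨K, z⟩ ⟨hK, hz⟩
    have hR : ContinuousAt (fun p : (H →L[ℂ] H) × ℂ => R p.2) (K, z) :=
      ContinuousAt.comp (f := Prod.snd) (x := (K, z)) (analyticAt_resolvent (hρ z hz)).continuousAt
        continuousAt_snd
    have hu : IsUnit (1 - K * R z) := isUnit_of_mem_resolventSet_perturb (hρ z hz) (hZρ K hK hz)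
    have hI : ContinuousAt (fun p : (H →L[ℂ] H) × ℂ => Ring.inverse (1 - p.1 * R p.2)) (K, z) :=
      ContinuousAt.comp (g := Ring.inverse) (x := (K, z))
        (NormedRing.inverse_continuousAt hu.unit) (continuousAt_const.sub (continuousAt_fst.mul hR))
    exact (hR.mul hI).continuousWithinAt
  obtain ⟨N, hN⟩ := (h𝒦.prod hZ).exists_bound_of_continuousOn hcont
  refine ⟨N, fun K hK z hz => ?_⟩
  have hu : IsUnit (1 - K * R z) := isUnit_of_mem_resolventSet_perturb (hρ z hz) (hZρ K hK hz)
  rw [((isResolventAt_resolvent (hρ z hz)).perturb hu).resolvent_eq]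
  exact hN (K, z) ⟨hK, hz⟩

end Banach

end C0Semigroup

namespace UnboundedOperator

section

variable {H : Type*} [NormedAddCommGroup H] [NormedSpace ℂ H] {A : H →ₗ.[ℂ] H} {ω₀ ω₁ : ℝ}

/-- Finitely many spectral points cannot fill a horizontal segment. -/
theorem exists_mem_resolventSet_re_near (hfin : (specRight A ω₀).Finite) (y : ℝ) {η : ℝ}
    (hη : 0 < η) : ∃ s : ℝ, ω₀ < s ∧ s < ω₀ + η ∧ (s + y * Complex.I : ℂ) ∈ resolventSet A := by
  have hinj : Function.Injective fun s : ℝ => (s + y * Complex.I : ℂ) := by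
    intro s t h
    have := congrArg Complex.re h
    simpa using this
  obtain ⟨s, hs, hsn⟩ := (Ioo_infinite (show ω₀ < ω₀ + η by linarith)).exists_notMem_finite
    (hfin.preimage hinj.injOn)
  refine ⟨s, hs.1, hs.2, ?_⟩
  by_contra hσ
  exact hsn ⟨hσ, by simpa using hs.1.le⟩

theorem specRight_eq_of_gap (h : ω₁ ≤ ω₀) (hgap : ∀ z ∈ spec A, ω₁ ≤ z.re → ω₀ ≤ z.re) :
    specRight A ω₁ = specRight A ω₀ :=
  Subset.antisymm (fun z hz => ⟨hz.1, hgap z hz.1 hz.2⟩) fun _ hz => ⟨hz.1, h.trans hz.2⟩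

theorem closedBall_subset_of_gap (hgap : ∀ z ∈ spec A, ω₁ ≤ z.re → ω₀ ≤ z.re) (c : ℝ) :
    closedBall (c : ℂ) (c - ω₁) ⊆ resolventSet A ∪ specRight A ω₀ := by
  intro z hz
  by_cases hρ : z ∈ resolventSet A
  · exact Or.inl hρ
  · exact Or.inr ⟨hρ, hgap z hρ (Complex.le_re_of_mem_closedBall hz)⟩

end

end UnboundedOperator

namespace C0Semigroup

open UnboundedOperator hiding resolvent resolventSet

variable {H : Type*} [NormedAddCommGroup H] [InnerProductSpace ℂ H] [CompleteSpace H]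
variable {S : C0Semigroup H} {M ω ω₀ : ℝ} {𝒦 : Set (H →L[ℂ] H)}

theorem exists_isIsolatingRadius_of_mem_specRight (hS : ∀ t : ℝ≥0, ‖S t‖ ≤ M * Real.exp (ω * t))
    (hω : ω < ω₀) {K : H →L[ℂ] H} (hK : IsCompactOperator K) :
    ∀ μ ∈ specRight (perturb S.generator K) ω₀, ∃ r, IsIsolatingRadius (perturb S.generator K) μ r :=
  fun _ hμ => exists_isIsolatingRadius hS hK (hω.trans_le hμ.2) hμ.1

/-- A uniform growth bound on the complement of the total projections gives a uniform bound for the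
reduced resolvents. -/
theorem exists_bound_reducedResolvent (hS : ∀ t : ℝ≥0, ‖S t‖ ≤ M * Real.exp (ω * t))
    (hω : ω < ω₀) (h𝒦 : IsCompact 𝒦) (hcomp : ∀ K ∈ 𝒦, IsCompactOperator K)
    {ω' M' : ℝ} (hω' : ω' < ω₀) (hM' : 0 ≤ M')
    (h : ∀ K ∈ 𝒦, ∃ T : C0Semigroup H, T.generator = perturb S.generator K ∧ ∀ τ : ℝ≥0,
      ‖T τ * (1 - totalProjection (perturb S.generator K) ω₀)‖ ≤
        M' * Real.exp (ω' * τ) * ‖1 - totalProjection (perturb S.generator K) ω₀‖) :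
    ∃ C : ℝ, 0 < C ∧ ∀ z : ℂ, ω₀ ≤ z.re → ∀ K ∈ 𝒦,
      ‖reducedResolvent (perturb S.generator K) ω₀ z‖ ≤ C := by
  obtain ⟨ω₁, hω₁, hω₁₀⟩ := exists_between (max_lt hω hω')
  have hωω₁ : ω < ω₁ := (le_max_left _ _).trans_lt hω₁
  have hω'ω₁ : ω' < ω₁ := (le_max_right _ _).trans_lt hω₁
  have hfin : ∀ K ∈ 𝒦, (specRight (perturb S.generator K) ω₀).Finite := fun K hK =>
    finite_specRight hS hω (hcomp K hK)
  have hiso : ∀ K ∈ 𝒦, ∀ μ ∈ specRight (perturb S.generator K) ω₀,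
      ∃ r, IsIsolatingRadius (perturb S.generator K) μ r := fun K hK =>
    exists_isIsolatingRadius_of_mem_specRight hS hω (hcomp K hK)
  -- An eigenvector x from the strip has P x = 0, so e^{zt} x would have to obey a growth bound of
  -- rate ω' < Re z.
  have hgap : ∀ K ∈ 𝒦, ∀ z ∈ spec (perturb S.generator K), ω₁ ≤ z.re → ω₀ ≤ z.re := by
    intro K hK z hz hzre
    by_contra! hlt
    obtain ⟨T, hT, hTb⟩ := h K hK
    obtain ⟨x, hx0, hx, hAx⟩ := exists_eigenvector_of_mem_spec hS (hcomp K hK)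
      (hωω₁.trans_le hzre) hz
    have hP := totalProjection_eigenvector (hfin K hK) (hiso K hK) hx hAx
      (fun h => absurd h.2 (not_le.2 hlt))
    have hTx : T.HasGeneratorAt x (z • x) := (generator_eq_iff.1 hT x (z • x)).2 ⟨hx, hAx⟩
    set q := ‖1 - totalProjection (perturb S.generator K) ω₀‖
    have hxpos : 0 < ‖x‖ := norm_pos_iff.2 hx0
    have hb (t : ℝ≥0) : Real.exp ((z.re - ω') * t) ≤ M' * q := by
      have h1 := ContinuousLinearMap.le_of_opNorm_le _ (hTb t) x
      rw [mul_apply_eq_comp, _root_.sub_apply, hP, one_apply_eq_self, sub_zero,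
        hTx.apply_eq_exp_smul, norm_smul, Complex.norm_exp, Complex.re_mul_ofReal] at h1
      have h2 := le_of_mul_le_mul_right h1 hxpos
      rw [sub_mul, Real.exp_sub, div_le_iff₀ (Real.exp_pos _)]
      linarith
    have hpos : 0 < z.re - ω' := by linarith
    -- At this time the bound reads e^u ≤ u with u = M' q, which is impossible.
    have h3 := hb (M' * q / (z.re - ω')).toNNReal
    have h4 : 0 ≤ M' * q := by positivity
    rw [Real.coe_toNNReal _ (div_nonneg h4 hpos.le), mul_div_cancel₀ _ hpos.ne'] at h3
    linarith [Real.add_one_le_exp (M' * q)]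
  obtain ⟨ρ, hρ⟩ := exists_bound_spec hS hω h𝒦 hcomp
  -- One circle for all K. It bounds ‖I - P‖ uniformly, which removes that factor from the assumed
  -- growth bound.
  obtain ⟨c, hc, hball⟩ := Complex.exists_ball_right hω₁₀ ρ
  have hcb : ∀ K ∈ 𝒦, closedBall (c : ℂ) (c - ω₁) ⊆
      UnboundedOperator.resolventSet (perturb S.generator K) ∪ specRight (perturb S.generator K) ω₀ :=
    fun K hK => closedBall_subset_of_gap (hgap K hK) c
  have hσ : ∀ K ∈ 𝒦, specRight (perturb S.generator K) ω₀ ⊆ ball (c : ℂ) (c - ω₁) := fun K hK z hz =>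
    hball z hz.2 (mem_closedBall_zero_iff.1 (hρ K hK hz))
  obtain ⟨N, hN⟩ := exists_bound_resolvent_perturb hS h𝒦 (isCompact_sphere (c : ℂ) (c - ω₁))
    (fun z hz => hωω₁.trans_le (Complex.le_re_of_mem_closedBall (sphere_subset_closedBall hz)))
    (fun K hK => sphere_subset_resolventSet (hcb K hK) (hσ K hK))
  have hr : 0 < c - ω₁ := sub_pos.2 hc
  set D := 1 + (c - ω₁) * |N| with hD
  have hD0 : 0 < D := by positivity
  have hQ : ∀ K ∈ 𝒦, ‖1 - totalProjection (perturb S.generator K) ω₀‖ ≤ D := by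
    intro K hK
    rw [(totalProjection_eq_rieszIntegral (hfin K hK) (hiso K hK) hr (hcb K hK) (hσ K hK)).1]
    refine (norm_sub_le _ _).trans (add_le_add ContinuousLinearMap.norm_id_le ?_)
    exact circleIntegral.norm_two_pi_i_inv_smul_integral_le_of_norm_le_const hr.le fun z hz =>
      (hN K hK z hz).trans (le_abs_self N)
  have hd : 0 < ω₁ - ω' := sub_pos.2 hω'ω₁
  refine ⟨M' * D / (ω₁ - ω') + 1, by positivity, fun z hz K hK => ?_⟩
  refine (norm_reducedResolvent_le_of_forall (hfin K hK) (hiso K hK)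
    (Ω := {w | ω₁ < w.re}) (C := M' * D / (ω₁ - ω'))
    (isOpen_lt continuous_const Complex.continuous_re) (hω₁₀.trans_le hz) ?_ ?_).trans (by linarith)
  · by_cases hzρ : z ∈ UnboundedOperator.resolventSet (perturb S.generator K)
    · exact Or.inl hzρ
    · exact Or.inr ⟨hzρ, hz⟩
  · intro w (hw : ω₁ < w.re) hwρ
    obtain ⟨T, hT, hTb⟩ := h K hK
    refine ContinuousLinearMap.opNorm_le_bound _ (by positivity) fun x => ?_
    have hb (t : ℝ≥0) : ‖T t ((1 - totalProjection (perturb S.generator K) ω₀) x)‖ ≤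
        M' * D * ‖x‖ * Real.exp (ω' * t) := by
      refine (ContinuousLinearMap.le_of_opNorm_le _ (hTb t) x).trans ?_
      calc _ ≤ M' * Real.exp (ω' * t) * D * ‖x‖ := by gcongr; exact hQ K hK
        _ = _ := by ring
    rw [← hT] at hwρ
    have h1 := norm_laplace_le hb (hω'ω₁.trans hw)
    rw [← resolvent_eq_laplace hb (hω'ω₁.trans hw) hwρ, hT] at h1
    refine h1.trans ?_
    rw [div_mul_eq_mul_div]
    gcongr

/-- A uniform bound for the reduced resolvents gives a uniform growth bound on the complement of the
total projections. -/
theorem exists_growth_bound_of_reducedResolvent (hM : 1 ≤ M)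
    (hS : ∀ t : ℝ≥0, ‖S t‖ ≤ M * Real.exp (ω * t))
    (hω : ω < ω₀) (h𝒦 : IsCompact 𝒦) (hcomp : ∀ K ∈ 𝒦, IsCompactOperator K) {C : ℝ} (hC0 : 0 < C)
    (hC : ∀ z : ℂ, ω₀ ≤ z.re → ∀ K ∈ 𝒦, ‖reducedResolvent (perturb S.generator K) ω₀ z‖ ≤ C) :
    ∃ ω' < ω₀, ∃ M' : ℝ, 1 ≤ M' ∧ ∀ τ : ℝ≥0, ∀ K ∈ 𝒦, ∀ T : C0Semigroup H,
      T.generator = perturb S.generator K →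
      ‖T τ * (1 - totalProjection (perturb S.generator K) ω₀)‖ ≤
        M' * Real.exp (ω' * τ) * ‖1 - totalProjection (perturb S.generator K) ω₀‖ := by
  -- Each z with ω₁ ≤ Re z < ω₀ is then within 2η of a resolvent point w with Re w ≥ ω₀, and 2ηC =
  -- 1/2.
  set η := 1 / (4 * C) with hη
  have hη0 : 0 < η := by positivity
  have hηC : 4 * (η * C) = 1 := by rw [hη]; field_simp
  set ω₁ := max (ω₀ - η) ((ω + ω₀) / 2) with hω₁
  have hω₁₀ : ω₁ < ω₀ := max_lt (by linarith) (by linarith)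
  have hωω₁ : ω < ω₁ := lt_of_lt_of_le (by linarith) (le_max_right _ _)
  have hηω₁ : ω₀ - η ≤ ω₁ := le_max_left _ _
  have hfin : ∀ K ∈ 𝒦, (specRight (perturb S.generator K) ω₀).Finite := fun K hK =>
    finite_specRight hS hω (hcomp K hK)
  have hiso : ∀ K ∈ 𝒦, ∀ μ ∈ specRight (perturb S.generator K) ω₀,
      ∃ r, IsIsolatingRadius (perturb S.generator K) μ r := fun K hK =>
    exists_isIsolatingRadius_of_mem_specRight hS hω (hcomp K hK)
  have hCρ : ∀ K ∈ 𝒦, ∀ z ∈ UnboundedOperator.resolventSet (perturb S.generator K), ω₀ ≤ z.re →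
      ‖UnboundedOperator.resolvent (perturb S.generator K) z *
        (1 - totalProjection (perturb S.generator K) ω₀)‖ ≤ C := by
    intro K hK z hz hzre
    rw [← reducedResolvent_of_mem hz]
    exact hC z hzre K hK
  have hnear : ∀ K ∈ 𝒦, ∀ z : ℂ, ω₁ ≤ z.re → z.re < ω₀ →
      ∃ w ∈ UnboundedOperator.resolventSet (perturb S.generator K), ω₀ ≤ w.re ∧ w ≠ z ∧
        ‖w - z‖ * C ≤ 1 / 2 := by
    intro K hK z hz hz'
    obtain ⟨s, hs, hs', hρ⟩ := exists_mem_resolventSet_re_near (hfin K hK) z.im hη0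
    refine ⟨_, hρ, by simpa using hs.le, fun h => ?_, ?_⟩
    · have := congrArg Complex.re h
      simp only [Complex.add_re, Complex.ofReal_re, Complex.mul_re, Complex.I_re, mul_zero,
        Complex.ofReal_im, Complex.I_im, zero_mul, sub_zero, add_zero] at this
      linarith
    · have e : (s + z.im * Complex.I : ℂ) - z = ((s - z.re : ℝ) : ℂ) := by
        apply Complex.ext <;> simp
      rw [e, Complex.norm_real, Real.norm_of_nonneg (by linarith)]
      nlinarith
  -- For an eigenvector killed by P, the bound at w gives |w - z|⁻¹ ≤ C, contradicting |w - z| C ≤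
  -- 1/2.
  have hgap : ∀ K ∈ 𝒦, ∀ z ∈ spec (perturb S.generator K), ω₁ ≤ z.re → ω₀ ≤ z.re := by
    intro K hK z hz hzre
    by_contra! hlt
    obtain ⟨x, hx0, hx, hAx⟩ := exists_eigenvector_of_mem_spec hS (hcomp K hK)
      (hωω₁.trans_le hzre) hz
    have hP := totalProjection_eigenvector (hfin K hK) (hiso K hK) hx hAx
      (fun h => absurd h.2 (not_le.2 hlt))
    obtain ⟨w, hwρ, hwre, hne, hw⟩ := hnear K hK z hzre hlt
    have h1 := ContinuousLinearMap.le_of_opNorm_le _ (hCρ K hK w hwρ hwre) x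
    rw [mul_apply_eq_comp, _root_.sub_apply, hP, one_apply_eq_self, sub_zero,
      resolvent_eq_of_eigenvector hx hAx hwρ hne, norm_smul, norm_inv] at h1
    have h2 := le_of_mul_le_mul_right h1 (norm_pos_iff.2 hx0)
    have h3 : 0 < ‖w - z‖ := norm_pos_iff.2 (sub_ne_zero.2 hne)
    have h4 : 1 ≤ ‖w - z‖ * C := by
      calc (1 : ℝ) = ‖w - z‖ * ‖w - z‖⁻¹ := (mul_inv_cancel₀ h3.ne').symm
        _ ≤ _ := by gcongr
    linarith
  obtain ⟨k, hk⟩ := h𝒦.isBounded.exists_norm_le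
  set w₀ := max (ω + 2 * M * (k + 1)) ω₀ with hw₀
  obtain ⟨M', hM', hmain⟩ := exists_growth_bound_of_resolvent_bound (H := H) (M₀ := 2 * M)
    (w₀ := w₀) (C := 2 * C) (a₁ := ω₁) (by linarith) (hω₁₀.le.trans (le_max_right _ _))
  refine ⟨ω₁, hω₁₀, M', hM', fun τ K hK T hT => ?_⟩
  set A := perturb S.generator K with hA
  obtain ⟨ρ, hρ⟩ := exists_bound_spec hS hω (isCompact_singleton (x := K))
    (by rintro _ rfl; exact hcomp _ hK)
  obtain ⟨c, hc, hball⟩ := Complex.exists_ball_right hω₁₀ ρ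
  have hcb := closedBall_subset_of_gap (hgap K hK) c
  have hσ : specRight A ω₀ ⊆ ball (c : ℂ) (c - ω₁) := fun z hz =>
    hball z hz.2 (mem_closedBall_zero_iff.1 (hρ K rfl hz))
  have hr : 0 < c - ω₁ := sub_pos.2 hc
  have hs := sphere_subset_resolventSet hcb hσ
  obtain ⟨hPeq, hPann⟩ := totalProjection_eq_rieszIntegral (hfin K hK) (hiso K hK) hr hcb hσ
  set Q := 1 - totalProjection A ω₀ with hQ
  have hQQ : Q * Q = Q := by
    rw [← hPeq] at hPann
    nth_rewrite 2 [hQ]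
    rw [mul_sub, mul_one, hPann, sub_zero]
  have hQcomm {B : H →L[ℂ] H} (hB : ∀ ζ ∈ sphere (c : ℂ) (c - ω₁),
      Commute B (UnboundedOperator.resolvent A ζ)) : Commute Q B := by
    have h1 := commute_rieszIntegral hr.le hs hB
    rw [← hPeq] at h1
    exact ((Commute.one_right B).sub_right h1).symm
  obtain ⟨T', hT', hT'b⟩ := exists_generator_eq_perturb S hM hS K (hk K hK)
  -- By uniqueness T inherits the growth estimate, which is uniform in K because k bounds all of 𝒦.
  have hTT' : T = T' := eq_of_generator_eq hT'b (hT.trans hT'.symm)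
  refine hmain T Q (fun t => ?_) hQQ (fun t => ?_) (fun z hz => ?_) ?_ (fun z hz hzρ => ?_) τ
  · rw [hTT']
    refine (hT'b t).trans ?_
    gcongr
    exact le_max_left _ _
  · refine hQcomm fun ζ hζ => ?_
    have := T.commute_resolvent t (z := ζ) (by rw [hT]; exact hs hζ)
    rwa [hT] at this
  · rw [hT] at hz ⊢
    exact hQcomm fun ζ hζ => resolvent_commute hz (hs hζ)
  · rw [hT, specRight_eq_of_gap hω₁₀.le (hgap K hK)]
    exact hfin K hK
  · rw [hT] at hzρ ⊢
    by_cases hlt : z.re < ω₀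
    · obtain ⟨w, hwρ, hwre, hne, hw⟩ := hnear K hK z hz hlt
      have h1 := hCρ K hK w hwρ hwre
      have h2 : UnboundedOperator.resolvent A z * Q = UnboundedOperator.resolvent A w * Q +
          (w - z) • ((UnboundedOperator.resolvent A w * Q) * (UnboundedOperator.resolvent A z * Q)) := by
        have hc1 : Commute Q (UnboundedOperator.resolvent A z) :=
          hQcomm fun ζ hζ => resolvent_commute hzρ (hs hζ)
        have e : UnboundedOperator.resolvent A w * Q * (UnboundedOperator.resolvent A z * Q) =
            UnboundedOperator.resolvent A w * UnboundedOperator.resolvent A z * Q := by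
          calc _ = UnboundedOperator.resolvent A w * (Q * UnboundedOperator.resolvent A z) * Q := by
                noncomm_ring
            _ = UnboundedOperator.resolvent A w * UnboundedOperator.resolvent A z * (Q * Q) := by
                rw [hc1.eq]; noncomm_ring
            _ = _ := by rw [hQQ]
        rw [e, ← smul_mul_assoc, ← resolvent_sub_resolvent hzρ hwρ, ← add_mul]
        congr 1
        abel
      -- Since |w - z| C ≤ 1/2, the last term can be absorbed, giving ‖R(z) Q‖ ≤ 2C: the bound
      -- extends to Re z ≥ ω₁.
      have h3 : ‖UnboundedOperator.resolvent A z * Q‖ ≤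
          C + ‖w - z‖ * (C * ‖UnboundedOperator.resolvent A z * Q‖) := by
        conv_lhs => rw [h2]
        refine (norm_add_le _ _).trans (add_le_add h1 ?_)
        rw [norm_smul]
        gcongr
        exact (norm_mul_le _ _).trans (by gcongr)
      nlinarith [norm_nonneg (UnboundedOperator.resolvent A z * Q)]
    · exact (hCρ K hK z hzρ (not_lt.1 hlt)).trans (by linarith)

end C0Semigroup

theorem theoremA1 {H : Type*} [NormedAddCommGroup H] [InnerProductSpace ℂ H] [CompleteSpace H]
    (hH : ¬ FiniteDimensional ℂ H)
    (S : C0Semigroup H) {n : ℕ} (B : Set (EuclideanSpace ℝ (Fin n)))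
    (hBne : B.Nonempty) (hB : IsCompact B)
    (L' : EuclideanSpace ℝ (Fin n) → H →L[ℂ] H)
    (hL'comp : ∀ β ∈ B, IsCompactOperator (L' β)) (hL'cont : ContinuousOn L' B)
    (L : EuclideanSpace ℝ (Fin n) → H →ₗ.[ℂ] H)
    (hL : ∀ β, L β = UnboundedOperator.perturb S.generator (L' β))
    (ω₀ : ℝ) (hω₀ : S.growthBound < (ω₀ : EReal)) :
    -- each perturbed operator `L β` generates exactly one strongly continuous semigroup
    (∀ β ∈ B, ∃! T : C0Semigroup H, T.generator = L β) ∧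
    -- the spectrum of `L β` in `Re z ≥ ω₀` consists of finitely many isolated points
    (∀ β ∈ B, (UnboundedOperator.specRight (L β) ω₀).Finite ∧
      ∀ μ ∈ UnboundedOperator.specRight (L β) ω₀,
        ∃ r : ℝ, UnboundedOperator.IsIsolatingRadius (L β) μ r) ∧
    -- the reduced resolvent is analytic, also across those points
    (∀ β ∈ B, AnalyticOnNhd ℂ (UnboundedOperator.reducedResolvent (L β) ω₀)
      (UnboundedOperator.resolventSet (L β) ∪ UnboundedOperator.specRight (L β) ω₀)) ∧
    -- uniform growth bound if and only if uniform bound of the reduced resolvents,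
    -- where `Sβ β` is the semigroup generated by `L β`
    ∀ Sβ : EuclideanSpace ℝ (Fin n) → C0Semigroup H, (∀ β ∈ B, (Sβ β).generator = L β) →
      ((∃ ω : ℝ, ω < ω₀ ∧ ∃ M : ℝ, 1 ≤ M ∧ ∀ τ : ℝ≥0, ∀ β ∈ B,
          ‖(Sβ β τ).comp
              (ContinuousLinearMap.id ℂ H - UnboundedOperator.totalProjection (L β) ω₀)‖
            ≤ M * Real.exp (ω * τ) *
              ‖ContinuousLinearMap.id ℂ H - UnboundedOperator.totalProjection (L β) ω₀‖) ↔
        ∃ C : ℝ, 0 < C ∧ ∀ z : ℂ, ω₀ ≤ z.re → ∀ β ∈ B,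
          ‖UnboundedOperator.reducedResolvent (L β) ω₀ z‖ ≤ C) := by
  obtain ⟨ω, hω, M, hM, hS⟩ := C0Semigroup.exists_norm_le_of_growthBound_lt hω₀
  have h𝒦 : IsCompact (L' '' B) := hB.image_of_continuousOn hL'cont
  have hcomp : ∀ K ∈ L' '' B, IsCompactOperator K := by
    rintro _ ⟨β, hβ, rfl⟩
    exact hL'comp β hβ
  simp only [hL]
  refine ⟨fun β _ => ?_, fun β hβ => ?_, fun β hβ => ?_, fun Sβ hSβ => ⟨?_, ?_⟩⟩
  · obtain ⟨T, hT, hTb⟩ := C0Semigroup.exists_generator_eq_perturb S hM hS (L' β) le_rfl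
    exact ⟨T, hT, fun T' hT' => C0Semigroup.eq_of_generator_eq hTb (hT'.trans hT.symm)⟩
  · exact ⟨C0Semigroup.finite_specRight hS hω (hL'comp β hβ),
      C0Semigroup.exists_isIsolatingRadius_of_mem_specRight hS hω (hL'comp β hβ)⟩
  · exact UnboundedOperator.analyticOnNhd_reducedResolvent
      (C0Semigroup.finite_specRight hS hω (hL'comp β hβ))
      (C0Semigroup.exists_isIsolatingRadius_of_mem_specRight hS hω (hL'comp β hβ))
  · rintro ⟨ω', hω', M', hM', h⟩
    obtain ⟨C, hC0, hC⟩ := C0Semigroup.exists_bound_reducedResolvent hS hω h𝒦 hcomp hω'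
      (zero_le_one.trans hM') (by
        rintro _ ⟨β, hβ, rfl⟩
        exact ⟨Sβ β, hSβ β hβ, fun τ => h τ β hβ⟩)
    exact ⟨C, hC0, fun z hz β hβ => hC z hz _ ⟨β, hβ, rfl⟩⟩
  · rintro ⟨C, hC0, hC⟩
    obtain ⟨ω', hω', M', hM', h⟩ := C0Semigroup.exists_growth_bound_of_reducedResolvent hM hS hω h𝒦
      hcomp hC0 (by
        rintro z hz _ ⟨β, hβ, rfl⟩
        exact hC z hz β hβ)
    exact ⟨ω', hω', M', hM', fun τ β hβ => h τ _ ⟨β, hβ, rfl⟩ (Sβ β) (hSβ β hβ)⟩
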